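/- **Setting.** Let $d\in\mathbb N$, $T>0$, and let $E\colon[0,T]\times\mathbb R^d\to\mathbb R$ satisfy * (E1) $E\in C^{1}([0,T]\times\mathbb R^d)$, and $\nabla_xE(t,\cdot)$ is Lipschitz continuous on bounded sets, uniformly in $t\in[0,T]$; * (E2) there are $C_1,C_2>0$ with $|\partial_tE(t,x)|\le C_1+C_2E(t,x)$ for all $(t,x)\in[0,T]\times\mathbb R^d$; * (E3) there are $C_3,C_4>0$ and $p>1$ with $C_3|x|^p-C_4\le E(t,x)$ for all $(t,x)\in[0,T]\times\mathbb R^d$; * (E4) for all $(t,u)\in[0,T]\times\mathbb R^d$ the set $C(t,u):=\{x\in\mathbb R^d:\nabla_xE(t,x)=u\}$ contains only isolated points. Let $f\colon\mathbb R^d\to\mathbb R^d$ satisfy * (E5) $f$ is locally Lipschitz and $|f(u)|\le C_f(1+|u|)$ for some constant $C_f$ and all $u\in\mathbb R^d$. Put $\overline E(t,x,u):=E(t,x)-u\cdot x$. For $t\in[0,T]$ and $x_1,x_2,u\in\mathbb R^d$ let $\mathcal A^t_{x_1,x_2,u}$ be the set of $\theta\in C([0,1];\mathbb R^d)$ with $\theta(0)=x_1$,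 $\theta(1)=x_2$ for which there is a partition $0=t_0<\dots<t_m=1$ such that $\theta$ is locally Lipschitz on each $(t_i,t_{i+1})$, $\theta(t_i)\in C(t,u)$ for $i=1,\dots,m-1$, and $\theta(s)\notin C(t,u)$ for every $s\in[0,1]\setminus\{t_0,\dots,t_m\}$. Define $$c_t(x_1,x_2;u):=\inf\Big\{\int_0^1|\nabla_xE(t,\theta(s))-u|\,|\theta'(s)|\,ds:\ \theta\in\mathcal A^t_{x_1,x_2,u}\Big\}\in[0,\infty]\quad\text{if }x_1\ne x_2,$$ with $\inf\emptyset=\infty$, and $c_t(x_1,x_1;u):=0$. **Theorem.** Let $\varepsilon_n>0$, $\varepsilon_n\to0$, let $(x_0^n,u_0^n)\to(x_0,u_0)$ in $\mathbb R^d\times\mathbb R^d$, and let $(x_{\varepsilon_n},u_{\varepsilon_n})$ be the solution on $[0,T]$ of $$\varepsilon_n\dot x(t)=-\nabla_xE(t,x(t))+u(t),\qquad \dot u(t)=f(u(t)),\qquad (x(0),u(0))=(x_0^n,u_0^n).$$ Then there exist a function $x\colon[0,T]\to\mathbb R^d$ with $x\in L^\infty([0,T];\mathbb R^d)$, a function $u\in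 C([0,T];\mathbb R^d)$ and a finite positive Radon measure $\nu$ on $[0,T]$ such that: * (a) along a subsequence (the same for all the convergences), $x_{\varepsilon_n}\to x$ in $L^p([0,T];\mathbb R^d)$ for every $p\in[1,\infty)$ and $x_{\varepsilon_n}(t)\to x(t)$ for every $t\in[0,T]$, and $u_{\varepsilon_n}\to u$ uniformly on $[0,T]$; * (b) $\dot u=f(u)$ on $[0,T]$ and $u(0)=u_0$; * (c) $x$ admits a left limit $x_-(t)\in C(t,u(t))$ at every $t\in(0,T]$ and a right limit $x_+(t)\in C(t,u(t))$ at every $t\in[0,T)$. Set in addition $x_-(0):=x(0)$ and $x_+(T):=x(T)$; * (d) the set $J:=\{t\in[0,T]:\nu(\{t\})>0\}$ is at most countable and coincides with the set of discontinuity points of $x\colon[0,T]\to\mathbb R^d$; * (e) $\tau\mapsto\partial_tE(\tau,x(\tau))-f(u(\tau))\cdot x(\tau)$ is integrable on $[0,T]$, and for all $0\le s\le t\le T$ $$\overline E(t,x_+(t),u(t))+\nu([s,t])=\overline E(s,x_-(s),u(s))+\int_s^t\big[\partial_tE(\tau,x(\tau))-f(u(\tau))\cdot x(\tau)\big]\,d\tau;$$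 * (f) for every $t\in J$ we have $c_t(x_-(t),x_+(t);u(t))=\nu(\{t\})$. -/

import Mathlib

open Set Filter Topology MeasureTheory

namespace CriticalEvolution

/-- The state space `ℝ^d` with its Euclidean norm and inner product. -/
abbrev Vec (d : ℕ) := EuclideanSpace ℝ (Fin d)

variable {d : ℕ}

/-- `∇ₓE(t,x)`, the gradient of `E(t, ·)` at `x`. -/
noncomputable def gradX (E : ℝ → Vec d → ℝ) (t : ℝ) (x : Vec d) : Vec d :=
  gradient (E t) x

/-- `∂ₜE(t,x)`; only values of `E(·,x)` on `[0,T]` enter, so that the derivative is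
one-sided at `0` and at `T`. -/
noncomputable def partialT (T : ℝ) (E : ℝ → Vec d → ℝ) (t : ℝ) (x : Vec d) : ℝ :=
  derivWithin (fun s => E s x) (Icc 0 T) t

/-- `C(t,u) = {x : ∇ₓE(t,x) = u}`. -/
def critSet (E : ℝ → Vec d → ℝ) (t : ℝ) (u : Vec d) : Set (Vec d) :=
  {x | gradX E t x = u}

/-- The corrected energy `Ē(t,x,u) = E(t,x) - u · x`. -/
noncomputable def corrEnergy (E : ℝ → Vec d → ℝ) (t : ℝ) (x u : Vec d) : ℝ :=
  E t x - inner ℝ u x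

/-- The standing assumptions on the energy `E : [0,T] × ℝ^d → ℝ`. The values of `E` at times
outside `[0,T]` play no role. -/
structure IsEnergy (T : ℝ) (E : ℝ → Vec d → ℝ) : Prop where
  /-- `E` is of class `C¹` on `[0,T] × ℝ^d`. -/
  contDiffOn : ContDiffOn ℝ 1 (fun q : ℝ × Vec d => E q.1 q.2) (Icc 0 T ×ˢ univ)
  /-- `∇ₓE` is locally Lipschitz continuous in `x`, uniformly in `t ∈ [0,T]`. -/
  gradX_lipschitz : ∀ R : ℝ, ∃ L : NNReal, ∀ t ∈ Icc 0 T,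
    LipschitzOnWith L (gradX E t) (Metric.closedBall 0 R)
  /-- `|∂ₜE| ≤ C₁ + C₂ E`. -/
  power_control : ∃ C₁ C₂ : ℝ, 0 < C₁ ∧ 0 < C₂ ∧ ∀ t ∈ Icc 0 T, ∀ x : Vec d,
    |partialT T E t x| ≤ C₁ + C₂ * E t x
  /-- `C₃ |x|^p - C₄ ≤ E` for some `p > 1`. -/
  coercive : ∃ C₃ C₄ p : ℝ, 0 < C₃ ∧ 0 < C₄ ∧ 1 < p ∧ ∀ t ∈ Icc 0 T, ∀ x : Vec d,
    C₃ * ‖x‖ ^ p - C₄ ≤ E t x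
  /-- Every point of `C(t,u)` is isolated in `C(t,u)`. -/
  isolated : ∀ t ∈ Icc 0 T, ∀ u : Vec d, ∀ x ∈ critSet E t u,
    ∀ᶠ y in 𝓝[≠] x, y ∉ critSet E t u

/-- The standing assumptions on `f`: locally Lipschitz with linear growth. -/
structure IsControlField (f : Vec d → Vec d) : Prop where
  locallyLipschitz : LocallyLipschitz f
  growth : ∃ C : ℝ, ∀ u : Vec d, ‖f u‖ ≤ C * (1 + ‖u‖)

/-- `(x,u)` solves `ε x' = -∇ₓE(t,x) + u`, `u' = f(u)` on `[0,T]`, `(x,u)(0) = (x₀,u₀)`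
(derivatives at `0` and `T` are one-sided). -/
structure IsSolution (T : ℝ) (E : ℝ → Vec d → ℝ) (f : Vec d → Vec d) (ε : ℝ)
    (x₀ u₀ : Vec d) (x u : ℝ → Vec d) : Prop where
  state : ∀ t ∈ Icc 0 T,
    HasDerivWithinAt x (ε⁻¹ • (-gradX E t (x t) + u t)) (Icc 0 T) t
  control : ∀ t ∈ Icc 0 T, HasDerivWithinAt u (f (u t)) (Icc 0 T) t
  state_zero : x 0 = x₀
  control_zero : u 0 = u₀

/-- `θ : [0,1] → ℝ^d` is an admissible transition from `x₁` to `x₂` at time `t` with control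
`u`: it is continuous, joins `x₁` to `x₂`, and for some finite partition
`0 = τ 0 < ⋯ < τ m = 1` it is locally Lipschitz on the open intervals of the partition, meets
`C(t,u)` at the interior nodes and does not meet `C(t,u)` outside the nodes. -/
structure IsTransition (E : ℝ → Vec d → ℝ) (t : ℝ) (x₁ x₂ u : Vec d)
    (θ : ℝ → Vec d) : Prop where
  continuousOn : ContinuousOn θ (Icc 0 1)
  source : θ 0 = x₁
  target : θ 1 = x₂
  partition : ∃ (m : ℕ) (τ : ℕ → ℝ), τ 0 = 0 ∧ τ m = 1 ∧ (∀ i < m, τ i < τ (i + 1)) ∧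
    (∀ i < m, LocallyLipschitzOn (Ioo (τ i) (τ (i + 1))) θ) ∧
    (∀ i, 0 < i → i < m → θ (τ i) ∈ critSet E t u) ∧
    (∀ s ∈ Icc (0 : ℝ) 1, (∀ i ≤ m, s ≠ τ i) → θ s ∉ critSet E t u)

open Classical in
/-- The transition cost `c_t(x₁,x₂;u) ∈ [0,∞]`: the infimum of
`∫₀¹ |∇ₓE(t,θ(s)) - u| |θ'(s)| ds` over admissible transitions if `x₁ ≠ x₂` (so `∞` when there
is none), and `0` if `x₁ = x₂`. -/
noncomputable def transitionCost (E : ℝ → Vec d → ℝ) (t : ℝ) (x₁ x₂ u : Vec d) : ENNReal :=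
  if x₁ = x₂ then 0
  else ⨅ (θ : ℝ → Vec d) (_ : IsTransition E t x₁ x₂ u θ),
    ∫⁻ s in Icc (0 : ℝ) 1, ENNReal.ofReal (‖gradX E t (θ s) - u‖ * ‖deriv θ s‖)

/-- `xm` and `xp` are the functions of left and right limits of `x : [0,T] → ℝ^d`, with the
usual conventions `x₋(0) = x(0)` and `x₊(T) = x(T)`. -/
structure IsOneSidedLimits (T : ℝ) (x xm xp : ℝ → Vec d) : Prop where
  left : ∀ t ∈ Ioc 0 T, Tendsto x (𝓝[<] t) (𝓝 (xm t))
  right : ∀ t ∈ Ico 0 T, Tendsto x (𝓝[>] t) (𝓝 (xp t))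
  left_zero : xm 0 = x 0
  right_end : xp T = x T

/-- The atoms of `ν` in `[0,T]`. -/
def atomSet (T : ℝ) (ν : Measure ℝ) : Set ℝ :=
  {t | t ∈ Icc 0 T ∧ 0 < ν {t}}

/-- The discontinuity points of `x : [0,T] → ℝ^d`. -/
def discontinuitySet (T : ℝ) (x : ℝ → Vec d) : Set ℝ :=
  {t | t ∈ Icc 0 T ∧ ¬ ContinuousWithinAt x (Icc 0 T) t}

end CriticalEvolution

open CriticalEvolution

namespace CriticalEvolution

variable {d : ℕ} {T : ℝ} {E : ℝ → Vec d → ℝ} {f : Vec d → Vec d}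

/-! ### Calculus for the energy -/

/-! Along a solution of the viscous system the corrected energy changes at the rate `power - ε⁻¹
|∇ₓE - u|²`. Hence `dissipation`, that is, initial energy minus present energy plus the integrated
power, is nondecreasing in time, and coercivity with a Gronwall argument
(`IsSolution.exists_bounds`) bounds states, powers and dissipations uniformly in `ε`. Helly's
theorem extracts a monotone limit `G` of the dissipations, and `G` controls everything else.

The decisive estimate is `exists_dissipation_ge`. Critical points being isolated, a displacement of
fixed size near a fixed time must cross an annulus on which the force is bounded below by some `c >
0`; since `|force| |x'| = ε⁻¹ |force|²`, the crossing costs at least `c` times its width in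
dissipation, whatever `ε` is. So the states are asymptotically equicontinuous wherever `G` is
continuous. A diagonal extraction over the countably many jumps of `G` and a countable dense set of
times gives convergence at every time, and the limit `x` inherits one-sided limits from `G`. The
integral of `|force|²` equals `ε` times the dissipation and tends to zero, so `x(t)` is critical at
almost every time and its one-sided limits are critical.

By dominated convergence `G` is the dissipation of `x` itself. Taking `ν` to be the Stieltjes
measure of `G`, the energy balance is the difference of the formulas for the one-sided limits of
`G`, and the atoms of `ν` are the jumps of `G`, which are those of `x`.

At a jump, the mass `ν {t}` equals the drop of the frozen energy between `x₋(t)` and `x₊(t)`. Every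
admissible transition costs at least this drop, by the chain rule and Cauchy–Schwarz
(`IsTransition.energy_drop_le`). Conversely, `exists_joined` turns a solution on a short time
interval around `t` into a nearly optimal transition. Away from the finitely many relevant critical
points the true force is comparable to the frozen one up to a factor `1 + η`, so the cost is at most
`1 + η` times the dissipation; near those points the curve, which may meet the critical set
infinitely often, is replaced by short segments through the centers (`Joined.of_balls`). -/

lemma uniqueDiffOn_strip (hT : 0 < T) :
    UniqueDiffOn ℝ (Icc 0 T ×ˢ (univ : Set (Vec d))) :=
  (uniqueDiffOn_Icc hT).prod uniqueDiffOn_univ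

/-- The derivative of the energy on the space-time strip. -/
noncomputable def energyFDeriv (T : ℝ) (E : ℝ → Vec d → ℝ) (q : ℝ × Vec d) :
    ℝ × Vec d →L[ℝ] ℝ :=
  fderivWithin ℝ (fun q : ℝ × Vec d => E q.1 q.2) (Icc 0 T ×ˢ univ) q

namespace IsEnergy

lemma hasFDerivWithinAt (hE : IsEnergy T E) {t : ℝ} (ht : t ∈ Icc 0 T) (x : Vec d) :
    HasFDerivWithinAt (fun q : ℝ × Vec d => E q.1 q.2) (energyFDeriv T E (t, x))
      (Icc 0 T ×ˢ univ) (t, x) :=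
  ((hE.contDiffOn.differentiableOn one_ne_zero) (t, x) ⟨ht, mem_univ x⟩).hasFDerivWithinAt

lemma continuousOn_energyFDeriv (hT : 0 < T) (hE : IsEnergy T E) :
    ContinuousOn (energyFDeriv T E) (Icc 0 T ×ˢ univ) :=
  hE.contDiffOn.continuousOn_fderivWithin (uniqueDiffOn_strip hT) le_rfl

lemma hasFDerivAt_slice (hE : IsEnergy T E) {t : ℝ} (ht : t ∈ Icc 0 T) (x : Vec d) :
    HasFDerivAt (E t) ((energyFDeriv T E (t, x)).comp (ContinuousLinearMap.inr ℝ ℝ (Vec d))) x := by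
  have h := (hE.hasFDerivWithinAt ht x).comp x (s := univ)
    (hasFDerivAt_prodMk_right t x).hasFDerivWithinAt (fun y _ => ⟨ht, mem_univ y⟩)
  exact hasFDerivWithinAt_univ.1 h

lemma hasGradientAt (hE : IsEnergy T E) {t : ℝ} (ht : t ∈ Icc 0 T) (x : Vec d) :
    HasGradientAt (E t) (gradX E t x) x :=
  (hE.hasFDerivAt_slice ht x).differentiableAt.hasGradientAt

lemma inner_gradX (hE : IsEnergy T E) {t : ℝ} (ht : t ∈ Icc 0 T) (x v : Vec d) :
    inner ℝ (gradX E t x) v = energyFDeriv T E (t, x) (0, v) := by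
  have h := (hE.hasGradientAt ht x).hasFDerivAt.unique (hE.hasFDerivAt_slice ht x)
  have := DFunLike.congr_fun h v
  simpa using this

lemma partialT_eq (hT : 0 < T) (hE : IsEnergy T E) {t : ℝ} (ht : t ∈ Icc 0 T) (x : Vec d) :
    partialT T E t x = energyFDeriv T E (t, x) (1, 0) := by
  have h : HasDerivWithinAt (fun s => E s x) (energyFDeriv T E (t, x) (1, 0)) (Icc 0 T) t := by
    have hm : MapsTo (fun s => (s, x)) (Icc 0 T) (Icc 0 T ×ˢ (univ : Set (Vec d))) :=
      fun y hy => ⟨hy, mem_univ _⟩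
    exact (hE.hasFDerivWithinAt ht x).comp_hasDerivWithinAt t (s := Icc 0 T)
      ((hasDerivWithinAt_id t _).prodMk (hasDerivWithinAt_const t _ x)) hm
  exact h.derivWithin (uniqueDiffOn_Icc hT t ht)

lemma continuousOn_partialT (hT : 0 < T) (hE : IsEnergy T E) :
    ContinuousOn (fun q : ℝ × Vec d => partialT T E q.1 q.2) (Icc 0 T ×ˢ univ) := by
  refine ((hE.continuousOn_energyFDeriv hT).clm_apply (continuousOn_const (c := (1, 0)))).congr ?_
  rintro ⟨t, x⟩ ⟨ht, -⟩
  exact hE.partialT_eq hT ht x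

lemma continuousOn_gradX (hT : 0 < T) (hE : IsEnergy T E) :
    ContinuousOn (fun q : ℝ × Vec d => gradX E q.1 q.2) (Icc 0 T ×ˢ univ) := by
  have h : ContinuousOn (fun q : ℝ × Vec d => (InnerProductSpace.toDual ℝ (Vec d)).symm
      ((energyFDeriv T E q).comp (ContinuousLinearMap.inr ℝ ℝ (Vec d)))) (Icc 0 T ×ˢ univ) :=
    (InnerProductSpace.toDual ℝ (Vec d)).symm.continuous.comp_continuousOn
      ((hE.continuousOn_energyFDeriv hT).clm_comp continuousOn_const)
  refine h.congr ?_
  rintro ⟨t, x⟩ ⟨ht, -⟩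
  simp only
  rw [← (hE.hasFDerivAt_slice ht x).fderiv]
  rfl

lemma continuousOn_uncurry (hE : IsEnergy T E) :
    ContinuousOn (fun q : ℝ × Vec d => E q.1 q.2) (Icc 0 T ×ˢ univ) :=
  hE.contDiffOn.continuousOn

lemma hasDerivWithinAt_comp (hT : 0 < T) (hE : IsEnergy T E) {x : ℝ → Vec d} {v : Vec d} {t : ℝ}
    (ht : t ∈ Icc 0 T) (hx : HasDerivWithinAt x v (Icc 0 T) t) :
    HasDerivWithinAt (fun s => E s (x s)) (partialT T E t (x t) + inner ℝ (gradX E t (x t)) v)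
      (Icc 0 T) t := by
  have hm : MapsTo (fun s => (s, x s)) (Icc 0 T) (Icc 0 T ×ˢ (univ : Set (Vec d))) :=
    fun y hy => ⟨hy, mem_univ _⟩
  have := (hE.hasFDerivWithinAt ht (x t)).comp_hasDerivWithinAt_of_eq t (s := Icc 0 T)
      ((hasDerivWithinAt_id t _).prodMk hx) hm rfl
  refine this.congr_deriv ?_
  rw [hE.inner_gradX ht, hE.partialT_eq hT ht, ← map_add]
  simp

/-- Superlinear growth of the energy. -/
lemma exists_linear_le (hE : IsEnergy T E) (A : ℝ) :
    ∃ B : ℝ, 0 ≤ B ∧ ∀ t ∈ Icc 0 T, ∀ x, A * ‖x‖ - B ≤ E t x := by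
  obtain ⟨C₃, C₄, p, h3, h4, hp, h⟩ := hE.coercive
  have hlim : Tendsto (fun r : ℝ => r ^ (p - 1)) atTop atTop :=
    tendsto_rpow_atTop (by linarith)
  -- Beyond radius `R` the term `C₃ ‖x‖ ^ p` dominates `|A| ‖x‖`; inside radius `max R 1` the linear
  -- term is bounded and goes into `B`.
  obtain ⟨R, hR⟩ := eventually_atTop.1 (hlim.eventually_ge_atTop (|A| / C₃))
  refine ⟨|A| * max R 1 + C₄, by positivity, fun t ht x => ?_⟩
  have hA : A * ‖x‖ ≤ |A| * ‖x‖ := mul_le_mul_of_nonneg_right (le_abs_self A) (norm_nonneg x)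
  have hx := h t ht x
  rcases le_total ‖x‖ (max R 1) with hle | hle
  · have : |A| * ‖x‖ ≤ |A| * max R 1 := mul_le_mul_of_nonneg_left hle (abs_nonneg A)
    have : 0 ≤ C₃ * ‖x‖ ^ p := by positivity
    linarith
  · have h1 : 0 < ‖x‖ := lt_of_lt_of_le (by positivity) hle
    have h2 := hR ‖x‖ ((le_max_left _ _).trans hle)
    rw [div_le_iff₀ h3] at h2
    have h5 : ‖x‖ ^ p = ‖x‖ ^ (p - 1) * ‖x‖ := by
      rw [Real.rpow_sub_one h1.ne']; field_simp
    have h6 : |A| * ‖x‖ ≤ C₃ * ‖x‖ ^ p := by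
      rw [h5]; nlinarith
    have : 0 ≤ |A| * max R 1 := by positivity
    linarith

end IsEnergy

lemma isClosed_critSet (hT : 0 < T) (hE : IsEnergy T E) {t : ℝ} (ht : t ∈ Icc 0 T) (u : Vec d) :
    IsClosed (critSet E t u) := by
  have : Continuous (gradX E t) := by
    rw [← continuousOn_univ]
    exact (hE.continuousOn_gradX hT).comp (continuousOn_const.prodMk continuousOn_id)
      (fun y _ => ⟨ht, mem_univ _⟩)
  exact isClosed_eq this continuous_const

/-! ### The energy balance along solutions -/

/-- The power of the external forces along `(x, u)`. -/
noncomputable def power (T : ℝ) (E : ℝ → Vec d → ℝ) (f : Vec d → Vec d) (x u : ℝ → Vec d)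
    (τ : ℝ) : ℝ :=
  partialT T E τ (x τ) - inner ℝ (f (u τ)) (x τ)

/-- The energy dissipated along `(x, u)` up to time `t`. -/
noncomputable def dissipation (T : ℝ) (E : ℝ → Vec d → ℝ) (f : Vec d → Vec d) (x u : ℝ → Vec d)
    (t : ℝ) : ℝ :=
  corrEnergy E 0 (x 0) (u 0) - corrEnergy E t (x t) (u t) + ∫ τ in (0 : ℝ)..t, power T E f x u τ

lemma continuousOn_power (hT : 0 < T) (hE : IsEnergy T E) (hf : IsControlField f)
    {x u : ℝ → Vec d} (hx : ContinuousOn x (Icc 0 T)) (hu : ContinuousOn u (Icc 0 T)) :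
    ContinuousOn (power T E f x u) (Icc 0 T) := by
  refine ContinuousOn.sub ?_ ((hf.locallyLipschitz.continuous.comp_continuousOn hu).inner hx)
  exact (hE.continuousOn_partialT hT).comp (continuousOn_id.prodMk hx)
    (fun y hy => ⟨hy, mem_univ _⟩)

lemma hasDerivWithinAt_integral_of_continuousOn {F : Type*} [NormedAddCommGroup F]
    [NormedSpace ℝ F] [CompleteSpace F] {g : ℝ → F}
    (hg : ContinuousOn g (Icc 0 T)) {t : ℝ} (ht : t ∈ Icc 0 T) :
    HasDerivWithinAt (fun s => ∫ τ in (0 : ℝ)..s, g τ) (g t) (Icc 0 T) t := by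
  have : Fact (t ∈ Icc 0 T) := ⟨ht⟩
  refine intervalIntegral.integral_hasDerivWithinAt_right ?_ ?_ (hg t ht)
  · exact (hg.mono (by rw [uIcc_of_le ht.1]; exact Icc_subset_Icc_right ht.2)).intervalIntegrable
  · exact hg.stronglyMeasurableAtFilter_nhdsWithin measurableSet_Icc t

namespace IsSolution

variable {ε : ℝ} {x₀ u₀ : Vec d} {x u : ℝ → Vec d}

lemma continuousOn_state (h : IsSolution T E f ε x₀ u₀ x u) : ContinuousOn x (Icc 0 T) :=
  fun t ht => (h.state t ht).continuousWithinAt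

lemma continuousOn_control (h : IsSolution T E f ε x₀ u₀ x u) : ContinuousOn u (Icc 0 T) :=
  fun t ht => (h.control t ht).continuousWithinAt

lemma hasDerivWithinAt_corrEnergy (hT : 0 < T) (hE : IsEnergy T E)
    (h : IsSolution T E f ε x₀ u₀ x u) {t : ℝ} (ht : t ∈ Icc 0 T) :
    HasDerivWithinAt (fun s => corrEnergy E s (x s) (u s))
      (power T E f x u t - ε⁻¹ * ‖gradX E t (x t) - u t‖ ^ 2) (Icc 0 T) t := by
  have h1 := hE.hasDerivWithinAt_comp hT ht (h.state t ht)
  have h2 := (h.control t ht).inner ℝ (h.state t ht)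
  refine (h1.sub h2).congr_deriv ?_
  have h3 : -gradX E t (x t) + u t = -(gradX E t (x t) - u t) := by abel
  rw [power, h3, ← real_inner_self_eq_norm_sq]
  generalize inner ℝ (f (u t)) (x t) = a
  simp only [inner_smul_right, inner_neg_right, inner_sub_left, inner_sub_right]
  ring

/-- The integral of the power cancels the power produced by the chain rule and leaves only the
viscous term. -/
lemma hasDerivWithinAt_dissipation (hT : 0 < T) (hE : IsEnergy T E) (hf : IsControlField f)
    (h : IsSolution T E f ε x₀ u₀ x u) {t : ℝ} (ht : t ∈ Icc 0 T) :
    HasDerivWithinAt (dissipation T E f x u) (ε⁻¹ * ‖gradX E t (x t) - u t‖ ^ 2) (Icc 0 T) t := by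
  have h1 := hasDerivWithinAt_integral_of_continuousOn
    (continuousOn_power hT hE hf h.continuousOn_state h.continuousOn_control) ht
  refine (((h.hasDerivWithinAt_corrEnergy hT hE ht).const_sub _).add h1).congr_deriv ?_
  ring

lemma monotoneOn_dissipation (hT : 0 < T) (hE : IsEnergy T E) (hf : IsControlField f)
    (hε : 0 < ε) (h : IsSolution T E f ε x₀ u₀ x u) :
    MonotoneOn (dissipation T E f x u) (Icc 0 T) := by
  have hd := fun t ht => h.hasDerivWithinAt_dissipation hT hE hf (t := t) ht
  refine monotoneOn_of_hasDerivWithinAt_nonneg (convex_Icc 0 T)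
    (f' := fun t => ε⁻¹ * ‖gradX E t (x t) - u t‖ ^ 2)
    (fun t ht => (hd t ht).continuousWithinAt) (fun t ht => ?_) (fun t _ => by positivity)
  exact (hd t (interior_subset ht)).mono interior_subset

end IsSolution

/-! ### A priori bounds -/

lemma hasDerivWithinAt_Ici_of_Icc {F : Type*} [NormedAddCommGroup F] [NormedSpace ℝ F]
    {g : ℝ → F} {g' : F} {a b t : ℝ} (ht : t ∈ Ico a b)
    (h : HasDerivWithinAt g g' (Icc a b) t) : HasDerivWithinAt g g' (Ici t) t :=
  h.mono_of_mem_nhdsWithin (Icc_mem_nhdsGE_of_mem ht)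

lemma hasDerivAt_of_Icc {F : Type*} [NormedAddCommGroup F] [NormedSpace ℝ F]
    {g : ℝ → F} {g' : F} {a b t : ℝ} (ht : t ∈ Ioo a b)
    (h : HasDerivWithinAt g g' (Icc a b) t) : HasDerivAt g g' t :=
  h.hasDerivAt (Icc_mem_nhds ht.1 ht.2)

/-- Linear growth bounds the trajectories of the control equation. -/
lemma IsControlField.exists_bound (hf : IsControlField f) (T R : ℝ) :
    ∃ U : ℝ, 0 ≤ U ∧ ∀ u : ℝ → Vec d,
      (∀ t ∈ Icc 0 T, HasDerivWithinAt u (f (u t)) (Icc 0 T) t) → ‖u 0‖ ≤ R →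
      ∀ t ∈ Icc 0 T, ‖u t‖ ≤ U := by
  obtain ⟨C, hC⟩ := hf.growth
  have hC0 : 0 ≤ C := by
    have := (norm_nonneg _).trans (hC 0); simpa using this
  refine ⟨max 0 (gronwallBound (max R 0) C C T), le_max_left _ _, fun u hu h0 t ht => ?_⟩
  have h1 := norm_le_gronwallBound_of_norm_deriv_right_le (f := u) (f' := fun t => f (u t))
    (K := C) (ε := C)
    (fun t ht => (hu t ht).continuousWithinAt)
    (fun t ht => hasDerivWithinAt_Ici_of_Icc ht (hu t (Ico_subset_Icc_self ht)))
    (h0.trans (le_max_left R 0)) (fun t _ => (hC _).trans (by linarith)) t ht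
  refine (h1.trans ?_).trans (le_max_right _ _)
  exact gronwallBound_mono (le_max_right _ _) hC0 hC0 (by linarith [ht.2])

lemma IsControlField.lipschitzOn_closedBall (hf : IsControlField f) (R : ℝ) :
    ∃ K, LipschitzOnWith K f (Metric.closedBall 0 R) :=
  (hf.locallyLipschitz.locallyLipschitzOn.mono (subset_univ _)).exists_lipschitzOnWith_of_compact
    (isCompact_closedBall 0 R)

/-- Stability of the control equation under perturbations of the initial value. -/
lemma IsControlField.exists_tendstoUniformlyOn (hT : 0 < T) (hf : IsControlField f)
    {u₀n : ℕ → Vec d} {u₀ : Vec d} (hu₀ : Tendsto u₀n atTop (𝓝 u₀)) {un : ℕ → ℝ → Vec d}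
    (hun : ∀ n, ∀ t ∈ Icc 0 T, HasDerivWithinAt (un n) (f (un n t)) (Icc 0 T) t)
    (hun0 : ∀ n, un n 0 = u₀n n) :
    ∃ u : ℝ → Vec d, TendstoUniformlyOn un u atTop (Icc 0 T) ∧
      (∀ t ∈ Icc 0 T, HasDerivWithinAt u (f (u t)) (Icc 0 T) t) ∧ u 0 = u₀ ∧
      ∃ U : ℝ, 0 ≤ U ∧ (∀ n, ∀ t ∈ Icc 0 T, ‖un n t‖ ≤ U) := by
  have h0T : (0 : ℝ) ∈ Icc 0 T := ⟨le_rfl, hT.le⟩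
  obtain ⟨R, hR⟩ := hu₀.norm.bddAbove_range
  obtain ⟨U, hU0, hU⟩ := hf.exists_bound T R
  have hb : ∀ n, ∀ t ∈ Icc 0 T, ‖un n t‖ ≤ U := fun n =>
    hU (un n) (hun n) (by rw [hun0]; exact hR ⟨n, rfl⟩)
  have hmem : ∀ n, ∀ t ∈ Icc 0 T, un n t ∈ Metric.closedBall (0 : Vec d) U := fun n t ht => by
    simpa using hb n t ht
  have hcont : ∀ n, ContinuousOn (un n) (Icc 0 T) := fun n t ht => (hun n t ht).continuousWithinAt
  obtain ⟨K, hK⟩ := hf.lipschitzOn_closedBall U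
  -- All controls stay in one ball, on which `f` has a single Lipschitz constant, so Gronwall
  -- compares any two of them.
  have hdist : ∀ m n, ∀ t ∈ Icc 0 T,
      dist (un m t) (un n t) ≤ dist (u₀n m) (u₀n n) * Real.exp (K * T) := by
    intro m n t ht
    have := dist_le_of_trajectories_ODE_of_mem (v := fun _ => f)
      (s := fun _ => Metric.closedBall 0 U) (K := K) (fun _ _ => hK) (hcont m)
      (fun t ht => hasDerivWithinAt_Ici_of_Icc ht (hun m t (Ico_subset_Icc_self ht)))
      (fun t ht => hmem m t (Ico_subset_Icc_self ht)) (hcont n)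
      (fun t ht => hasDerivWithinAt_Ici_of_Icc ht (hun n t (Ico_subset_Icc_self ht)))
      (fun t ht => hmem n t (Ico_subset_Icc_self ht)) le_rfl t ht
    rw [hun0, hun0] at this
    refine this.trans (mul_le_mul_of_nonneg_left (Real.exp_le_exp.2 ?_) dist_nonneg)
    exact mul_le_mul_of_nonneg_left (by linarith [ht.2]) K.2
  have hcauchy : UniformCauchySeqOn un atTop (Icc 0 T) := by
    rw [Metric.uniformCauchySeqOn_iff]
    intro η hη
    obtain ⟨N, hN⟩ := Metric.cauchySeq_iff.1 hu₀.cauchySeq (η / Real.exp (K * T)) (by positivity)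
    refine ⟨N, fun m hm n hn t ht => (hdist m n t ht).trans_lt ?_⟩
    rw [← lt_div_iff₀ (Real.exp_pos _)]
    exact hN m hm n hn
  have hlim : ∀ t ∈ Icc 0 T, ∃ y, Tendsto (fun n => un n t) atTop (𝓝 y) := fun t ht =>
    cauchySeq_tendsto_of_complete (hcauchy.cauchySeq ht)
  choose! u hu using hlim
  have hunif : TendstoUniformlyOn un u atTop (Icc 0 T) :=
    hcauchy.tendstoUniformlyOn_of_tendsto hu
  have hucont : ContinuousOn u (Icc 0 T) :=
    hunif.continuousOn (Frequently.of_forall hcont)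
  have hfc := hf.locallyLipschitz.continuous
  have hu0 : u 0 = u₀ := tendsto_nhds_unique (hu 0 h0T) (by simpa only [hun0] using hu₀)
  obtain ⟨C, hC⟩ := hf.growth
  have hC0 : 0 ≤ C := by
    have := (norm_nonneg _).trans (hC 0); simpa using this
  -- The limit passes through the integral form of the equation, from which differentiability of `u`
  -- is recovered.
  have hint : ∀ t ∈ Icc 0 T, u t = u₀ + ∫ τ in (0 : ℝ)..t, f (u τ) := by
    intro t ht
    have hsub : Icc 0 t ⊆ Icc 0 T := Icc_subset_Icc_right ht.2
    have hn : ∀ n, un n t = u₀n n + ∫ τ in (0 : ℝ)..t, f (un n τ) := by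
      intro n
      rw [intervalIntegral.integral_eq_sub_of_hasDerivAt_of_le ht.1 ((hcont n).mono hsub)
        (fun s hs => hasDerivAt_of_Icc ⟨hs.1, hs.2.trans_le ht.2⟩
          (hun n s (hsub (Ioo_subset_Icc_self hs)))), hun0]
      · abel
      · refine ContinuousOn.intervalIntegrable ?_
        rw [uIcc_of_le ht.1]
        exact (hfc.comp_continuousOn (hcont n)).mono hsub
    have hsub' : uIoc 0 t ⊆ Icc 0 T := by
      rw [uIoc_of_le ht.1]; exact Ioc_subset_Icc_self.trans hsub
    refine tendsto_nhds_unique (hu t ht) ?_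
    rw [funext hn]
    refine hu₀.add (intervalIntegral.tendsto_integral_filter_of_dominated_convergence
      (fun _ => C * (1 + U)) ?_ ?_ intervalIntegrable_const ?_)
    · exact Eventually.of_forall fun n =>
        ((hfc.comp_continuousOn (hcont n)).mono hsub').aestronglyMeasurable measurableSet_uIoc
    · refine Eventually.of_forall fun n => Eventually.of_forall fun s hs => (hC _).trans ?_
      have := hb n s (hsub' hs)
      gcongr
    · exact Eventually.of_forall fun s hs => (hfc.tendsto _).comp (hu s (hsub' hs))
  refine ⟨u, hunif, fun t ht => ?_, hu0, U, hU0, hb⟩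
  have := (hasDerivWithinAt_integral_of_continuousOn (hfc.comp_continuousOn hucont) ht).const_add u₀
  exact this.congr_of_mem hint ht

/-- Uniform bounds for solutions with bounded control and bounded initial energy. -/
lemma IsSolution.exists_bounds (hT : 0 < T) (hE : IsEnergy T E) (hf : IsControlField f)
    {U : ℝ} (hU : 0 ≤ U) (G₀ : ℝ) :
    ∃ M P K : ℝ, 0 ≤ M ∧ 0 ≤ P ∧ 0 ≤ K ∧
      ∀ (ε : ℝ) (x₀ u₀ : Vec d) (x u : ℝ → Vec d), 0 < ε → IsSolution T E f ε x₀ u₀ x u →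
      (∀ t ∈ Icc 0 T, ‖u t‖ ≤ U) → corrEnergy E 0 (x 0) (u 0) ≤ G₀ →
      ∀ t ∈ Icc 0 T, ‖x t‖ ≤ M ∧ |power T E f x u t| ≤ P ∧ dissipation T E f x u t ≤ K := by
  obtain ⟨C₁, C₂, hC₁, hC₂, hpow⟩ := hE.power_control
  obtain ⟨C, hC⟩ := hf.growth
  have hC0 : 0 ≤ C := by
    have := (norm_nonneg _).trans (hC 0); simpa using this
  set F := C * (1 + U) with hF
  have hF0 : 0 ≤ F := by positivity
  -- With slope `2 (U + F + 1)`, half of `E` absorbs `u · x`, and the corrected energy still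
  -- controls `(F + 1) ‖x‖`. The constants `a` and `b` then come from `C₁ + C₂ E + F ‖x‖ ≤ C₁ + C₂
  -- (2 g + B) + (g + B)`.
  obtain ⟨B, hB0, hB⟩ := hE.exists_linear_le (2 * (U + F + 1))
  set a := C₁ + C₂ * B + B with ha
  set b := 2 * C₂ + 1 with hb
  have ha0 : 0 < a := by positivity
  have hb0 : 0 < b := by positivity
  set G := max 0 (Real.exp (b * T) * (|G₀| + a / b)) with hG
  have hG0 : 0 ≤ G := le_max_left _ _
  refine ⟨G + B, a + b * G, |G₀| + B + T * (a + b * G), by positivity, by positivity,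
    by positivity, fun ε x₀ u₀ x u hε h hu hG₀ => ?_⟩
  set g : ℝ → ℝ := fun t => corrEnergy E t (x t) (u t) with hg
  have hfu : ∀ t ∈ Icc 0 T, ‖f (u t)‖ ≤ F := fun t ht =>
    (hC _).trans (mul_le_mul_of_nonneg_left (by linarith [hu t ht]) hC0)
  have key : ∀ t ∈ Icc 0 T, (F + 1) * ‖x t‖ ≤ g t + B ∧ E t (x t) ≤ 2 * g t + B := by
    intro t ht
    have h1 := hB t ht (x t)
    have h2 : inner ℝ (u t) (x t) ≤ U * ‖x t‖ := (real_inner_le_norm _ _).trans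
      (mul_le_mul_of_nonneg_right (hu t ht) (norm_nonneg _))
    have h3 : g t = E t (x t) - inner ℝ (u t) (x t) := rfl
    have h4 : 0 ≤ F * ‖x t‖ := by positivity
    have h5 := norm_nonneg (x t)
    constructor <;> nlinarith
  have hpower : ∀ t ∈ Icc 0 T, |power T E f x u t| ≤ a + b * g t := by
    intro t ht
    obtain ⟨h1, h2⟩ := key t ht
    have h3 := hpow t ht (x t)
    have h4 : |inner ℝ (f (u t)) (x t)| ≤ F * ‖x t‖ := (abs_real_inner_le_norm _ _).trans
      (mul_le_mul_of_nonneg_right (hfu t ht) (norm_nonneg _))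
    have h5 : |power T E f x u t| ≤ |partialT T E t (x t)| + |inner ℝ (f (u t)) (x t)| :=
      abs_sub _ _
    have h6 := norm_nonneg (x t)
    have h7 : C₂ * E t (x t) ≤ C₂ * (2 * g t + B) := mul_le_mul_of_nonneg_left h2 hC₂.le
    rw [ha, hb]
    nlinarith
  have hd := fun t ht => h.hasDerivWithinAt_corrEnergy hT hE (t := t) ht
  -- Gronwall's inequality for `g' ≤ a + b g`, with integrating factor `exp (-b t)`.
  have hanti : AntitoneOn (fun t => Real.exp (-b * t) * (g t + a / b)) (Icc 0 T) := by
    have hder : ∀ t ∈ Icc 0 T, HasDerivWithinAt (fun t => Real.exp (-b * t) * (g t + a / b))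
        (Real.exp (-b * t) * (-b) * (g t + a / b) + Real.exp (-b * t) *
          (power T E f x u t - ε⁻¹ * ‖gradX E t (x t) - u t‖ ^ 2)) (Icc 0 T) t := by
      intro t ht
      have h1 : HasDerivWithinAt (fun t => Real.exp (-b * t)) (Real.exp (-b * t) * (-b))
          (Icc 0 T) t := by
        have := ((hasDerivAt_id t).const_mul (-b)).exp.hasDerivWithinAt (s := Icc 0 T)
        simpa using this
      exact h1.mul ((hd t ht).add_const _)
    refine antitoneOn_of_hasDerivWithinAt_nonpos (convex_Icc 0 T)
      (fun t ht => (hder t ht).continuousWithinAt)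
      (fun t ht => (hder t (interior_subset ht)).mono interior_subset) (fun t ht => ?_)
    have h1 := (abs_le.1 (hpower t (interior_subset ht))).2
    have h2 : 0 ≤ ε⁻¹ * ‖gradX E t (x t) - u t‖ ^ 2 := by positivity
    have h3 : b * (a / b) = a := by field_simp
    have h4 : Real.exp (-b * t) * (-b) * (g t + a / b) + Real.exp (-b * t) *
          (power T E f x u t - ε⁻¹ * ‖gradX E t (x t) - u t‖ ^ 2) =
        Real.exp (-b * t) * (power T E f x u t - ε⁻¹ * ‖gradX E t (x t) - u t‖ ^ 2
          - b * g t - b * (a / b)) := by ring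
    rw [h4]
    exact mul_nonpos_of_nonneg_of_nonpos (Real.exp_pos _).le (by linarith)
  have hgG : ∀ t ∈ Icc 0 T, g t ≤ G := by
    intro t ht
    have h1 := hanti ⟨le_rfl, hT.le⟩ ht ht.1
    simp only [mul_zero, Real.exp_zero, one_mul] at h1
    have h2 : g t + a / b ≤ Real.exp (b * t) * (g 0 + a / b) := by
      calc g t + a / b = Real.exp (b * t) * (Real.exp (-b * t) * (g t + a / b)) := by
            rw [← mul_assoc, ← Real.exp_add]; simp
        _ ≤ _ := mul_le_mul_of_nonneg_left h1 (Real.exp_pos _).le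
    have h3 : g 0 + a / b ≤ |G₀| + a / b := by linarith [hG₀.trans (le_abs_self G₀)]
    have h4 : Real.exp (b * t) * (g 0 + a / b) ≤ Real.exp (b * T) * (|G₀| + a / b) :=
      (mul_le_mul_of_nonneg_left h3 (Real.exp_pos _).le).trans
        (mul_le_mul_of_nonneg_right (Real.exp_le_exp.2 (mul_le_mul_of_nonneg_left ht.2 hb0.le))
          (by positivity))
    have h5 : 0 < a / b := by positivity
    exact le_trans (by linarith) (le_max_right _ _)
  have hP : ∀ t ∈ Icc 0 T, |power T E f x u t| ≤ a + b * G := fun t ht =>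
    (hpower t ht).trans (by have := mul_le_mul_of_nonneg_left (hgG t ht) hb0.le; linarith)
  intro t ht
  obtain ⟨h1, h2⟩ := key t ht
  have hx := norm_nonneg (x t)
  have hFx : 0 ≤ F * ‖x t‖ := by positivity
  refine ⟨by linarith [hgG t ht], hP t ht, ?_⟩
  have h3 : |∫ τ in (0 : ℝ)..t, power T E f x u τ| ≤ (a + b * G) * |t - 0| := by
    refine intervalIntegral.norm_integral_le_of_norm_le_const (f := power T E f x u)
      (fun s hs => ?_)
    rw [uIoc_of_le ht.1] at hs
    exact hP s ⟨hs.1.le, hs.2.trans ht.2⟩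
  rw [sub_zero, abs_of_nonneg ht.1] at h3
  have h4 : (a + b * G) * t ≤ T * (a + b * G) := by
    rw [mul_comm]; exact mul_le_mul_of_nonneg_right ht.2 (by positivity)
  have h5 : dissipation T E f x u t = g 0 - g t + ∫ τ in (0 : ℝ)..t, power T E f x u τ := rfl
  have h6 : g 0 ≤ |G₀| := hG₀.trans (le_abs_self _)
  have h7 := (abs_le.1 h3).2
  rw [h5]
  nlinarith

/-! ### Compactness -/

/-- Diagonal extraction on a countable index set. -/
lemma exists_subseq_tendsto_of_countable {X ι : Type*} [PseudoMetricSpace X] {K : Set X}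
    (hK : IsCompact K) {S : Set ι} (hS : S.Countable) (F : ℕ → ι → X)
    (hF : ∀ n, ∀ s ∈ S, F n s ∈ K) :
    ∃ φ : ℕ → ℕ, StrictMono φ ∧ ∀ s ∈ S, ∃ y ∈ K, Tendsto (fun k => F (φ k) s) atTop (𝓝 y) := by
  have := hS.to_subtype
  -- Tychonoff's theorem replaces the diagonal argument; countability of the index set makes
  -- compactness sequential.
  obtain ⟨a, ha, φ, hφ, hlim⟩ := (isCompact_univ_pi (fun _ : S => hK)).isSeqCompact
    (x := fun n s => F n s) (fun n s _ => hF n s s.2)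
  rw [tendsto_pi_nhds] at hlim
  exact ⟨φ, hφ, fun s hs => ⟨a ⟨s, hs⟩, ha ⟨s, hs⟩ (mem_univ _), hlim ⟨s, hs⟩⟩⟩

/-- Helly's selection theorem for uniformly bounded monotone functions. -/
theorem exists_subseq_tendsto_of_monotone {F : ℕ → ℝ → ℝ} (hmono : ∀ n, Monotone (F n))
    {a b : ℝ} (hF : ∀ n t, F n t ∈ Icc a b) :
    ∃ φ : ℕ → ℕ, StrictMono φ ∧ ∃ G : ℝ → ℝ, Monotone G ∧
      ∀ t, Tendsto (fun k => F (φ k) t) atTop (𝓝 (G t)) := by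
  obtain ⟨φ, hφ, hlim⟩ := exists_subseq_tendsto_of_countable (isCompact_Icc (a := a) (b := b))
    (countable_range ((↑) : ℚ → ℝ)) F (fun n s _ => hF n s)
  have hba : ∀ t, IsBoundedUnder (· ≤ ·) atTop (fun k => F (φ k) t) := fun t =>
    isBoundedUnder_of ⟨b, fun k => (hF _ _).2⟩
  have hbb : ∀ t, IsBoundedUnder (· ≥ ·) atTop (fun k => F (φ k) t) := fun t =>
    isBoundedUnder_of ⟨a, fun k => (hF _ _).1⟩
  -- The limsup is monotone and agrees with the limit at rationals. At a continuity point `t` of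
  -- `L`, a rational slightly below `t` bounds the liminf from below, so the sequence converges
  -- there.
  set L : ℝ → ℝ := fun t => limsup (fun k => F (φ k) t) atTop with hL
  have hLmono : Monotone L := fun s t hst =>
    limsup_le_limsup (Eventually.of_forall fun k => hmono _ hst) (hbb s).isCoboundedUnder_le (hba t)
  have hcont : ∀ t, ContinuousAt L t → Tendsto (fun k => F (φ k) t) atTop (𝓝 (L t)) := by
    intro t ht
    refine tendsto_of_le_liminf_of_limsup_le ?_ le_rfl (hba t) (hbb t)
    refine le_of_forall_lt (fun c hc => ?_)
    obtain ⟨l, hl, hlt⟩ := exists_Ioc_subset_of_mem_nhds (ht.eventually_const_lt hc)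
      ⟨t - 1, by linarith⟩
    obtain ⟨q, hq1, hq2⟩ := exists_rat_btwn hl
    have h1 : c < L q := hlt ⟨hq1, hq2.le⟩
    obtain ⟨y, -, hy⟩ := hlim q ⟨q, rfl⟩
    have h2 : L q = liminf (fun k => F (φ k) q) atTop := hy.limsup_eq.trans hy.liminf_eq.symm
    rw [h2] at h1
    exact h1.trans_le (liminf_le_liminf (Eventually.of_forall fun k => hmono _ hq2.le) (hbb q)
      (hba t).isCoboundedUnder_ge)
  -- Only the countably many discontinuities of `L` remain, and a second extraction handles them.
  obtain ⟨ψ, hψ, hlim'⟩ := exists_subseq_tendsto_of_countable (isCompact_Icc (a := a) (b := b))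
    hLmono.countable_not_continuousAt (fun k => F (φ k)) (fun n s _ => hF _ s)
  have hall : ∀ t, ∃ y, Tendsto (fun k => F (φ (ψ k)) t) atTop (𝓝 y) := by
    intro t
    by_cases ht : ContinuousAt L t
    · exact ⟨_, (hcont t ht).comp hψ.tendsto_atTop⟩
    · obtain ⟨y, -, hy⟩ := hlim' t ht
      exact ⟨y, hy⟩
  choose G hG using hall
  exact ⟨φ ∘ ψ, hφ.comp hψ, G, fun s t hst =>
    le_of_tendsto_of_tendsto' (hG s) (hG t) (fun k => hmono _ hst), hG⟩

/-! ### Transitions cost energy -/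

/-- For critical `y` this is isolatedness, for other `y` closedness of the critical set. Treating
both cases at once allows covering arguments in which the centers need not be critical. -/
lemma IsEnergy.exists_punctured_ball (hT : 0 < T) (hE : IsEnergy T E) {t : ℝ} (ht : t ∈ Icc 0 T)
    (u y : Vec d) : ∃ r > 0, ∀ z ∈ Metric.ball y r, z ≠ y → z ∉ critSet E t u := by
  have h : ∀ᶠ z in 𝓝[≠] y, z ∉ critSet E t u := by
    by_cases hy : y ∈ critSet E t u
    · exact hE.isolated t ht u y hy
    · exact nhdsWithin_le_nhds ((isClosed_critSet hT hE ht u).isOpen_compl.mem_nhds hy)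
  rw [eventually_nhdsWithin_iff, Metric.eventually_nhds_iff_ball] at h
  exact h

/-- Near time `t` the forces along the approximating control are close to the limiting ones,
uniformly on compact sets. -/
lemma IsEnergy.exists_force_close (hT : 0 < T) (hE : IsEnergy T E) {un : ℕ → ℝ → Vec d}
    {u : ℝ → Vec d} (hunif : TendstoUniformlyOn un u atTop (Icc 0 T))
    (hucont : ContinuousOn u (Icc 0 T)) {K : Set (Vec d)} (hK : IsCompact K) {t : ℝ}
    (ht : t ∈ Icc 0 T) {κ : ℝ} (hκ : 0 < κ) :
    ∃ δ > 0, ∃ N : ℕ, ∀ n ≥ N, ∀ τ ∈ Icc 0 T, |τ - t| < δ → ∀ z ∈ K,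
      ‖(gradX E τ z - un n τ) - (gradX E t z - u t)‖ ≤ κ := by
  have huc := (isCompact_Icc.prod hK).uniformContinuousOn_of_continuous
    ((hE.continuousOn_gradX hT).mono (prod_mono_right (subset_univ K)))
  obtain ⟨δ₁, hδ₁, h1⟩ := Metric.uniformContinuousOn_iff.1 huc (κ / 3) (by positivity)
  obtain ⟨δ₂, hδ₂, h2⟩ := Metric.continuousWithinAt_iff.1 (hucont t ht) (κ / 3) (by positivity)
  obtain ⟨N, hN⟩ := eventually_atTop.1
    (Metric.tendstoUniformlyOn_iff.1 hunif (κ / 3) (by positivity))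
  refine ⟨min δ₁ δ₂, lt_min hδ₁ hδ₂, N, fun n hn τ hτ hd z hz => ?_⟩
  have e1 := h1 (τ, z) ⟨hτ, hz⟩ (t, z) ⟨ht, hz⟩ (by
    simpa [Prod.dist_eq, Real.dist_eq, hδ₁] using hd.trans_le (min_le_left _ _))
  have e2 := h2 hτ (by simpa [Real.dist_eq] using hd.trans_le (min_le_right _ _))
  have e3 := hN n hn τ hτ
  rw [dist_eq_norm] at e1 e2 e3
  have : (gradX E τ z - un n τ) - (gradX E t z - u t) =
    (gradX E τ z - gradX E t z) + (u τ - un n τ) - (u τ - u t) := by abel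
  rw [this]
  refine (norm_sub_le _ _).trans ?_
  have := norm_add_le (gradX E τ z - gradX E t z) (u τ - un n τ)
  simp only at e1
  linarith

/-- Take for `s₂` the first time at which `φ` reaches `r₂`, and for `s₁` the last time before `s₂`
at which `φ` is at most `r₁`. -/
lemma exists_crossing {φ : ℝ → ℝ} {a b r₁ r₂ : ℝ} (hab : a ≤ b) (hφ : ContinuousOn φ (Icc a b))
    (ha : φ a ≤ r₁) (hb : r₂ ≤ φ b) :
    ∃ s₁ ∈ Icc a b, ∃ s₂ ∈ Icc a b, s₁ ≤ s₂ ∧ φ s₁ ≤ r₁ ∧ r₂ ≤ φ s₂ ∧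
      ∀ s ∈ Ioo s₁ s₂, φ s ∈ Icc r₁ r₂ := by
  have hc2 : IsCompact (Icc a b ∩ φ ⁻¹' Ici r₂) :=
    isCompact_Icc.of_isClosed_subset (hφ.preimage_isClosed_of_isClosed isClosed_Icc isClosed_Ici)
      inter_subset_left
  obtain ⟨s₂, ⟨hs₂, hs₂'⟩, hmin⟩ := hc2.exists_isLeast ⟨b, ⟨hab, le_rfl⟩, hb⟩
  have hsub : Icc a s₂ ⊆ Icc a b := Icc_subset_Icc_right hs₂.2
  have hc1 : IsCompact (Icc a s₂ ∩ φ ⁻¹' Iic r₁) :=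
    isCompact_Icc.of_isClosed_subset
      ((hφ.mono hsub).preimage_isClosed_of_isClosed isClosed_Icc isClosed_Iic) inter_subset_left
  obtain ⟨s₁, ⟨hs₁, hs₁'⟩, hmax⟩ := hc1.exists_isGreatest ⟨a, ⟨le_rfl, hs₂.1⟩, ha⟩
  refine ⟨s₁, hsub hs₁, s₂, hs₂, hs₁.2, hs₁', hs₂', fun s hs => ?_⟩
  have hs' : s ∈ Icc a s₂ := ⟨hs₁.1.trans hs.1.le, hs.2.le⟩
  constructor
  · by_contra! hlt
    exact absurd (hmax ⟨hs', hlt.le⟩) (not_le.2 hs.1)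
  · by_contra! hlt
    exact absurd (hmin ⟨hsub hs', hlt.le⟩) (not_le.2 hs.2)

namespace IsSolution

variable {ε : ℝ} {x₀ u₀ : Vec d} {x u : ℝ → Vec d}

lemma norm_velocity (hε : 0 < ε) (t : ℝ) :
    ‖ε⁻¹ • (-gradX E t (x t) + u t)‖ = ε⁻¹ * ‖gradX E t (x t) - u t‖ := by
  rw [norm_smul, Real.norm_of_nonneg (by positivity), ← norm_neg (gradX E t (x t) - u t)]
  congr 2; abel

/-- Moving against a force of size at least `c` dissipates at least `c` times the distance. -/
lemma mul_norm_sub_le_dissipation (hT : 0 < T) (hE : IsEnergy T E) (hf : IsControlField f)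
    (hε : 0 < ε) (h : IsSolution T E f ε x₀ u₀ x u) {c a b : ℝ} (hc : 0 < c)
    (ha : a ∈ Icc 0 T) (hb : b ∈ Icc 0 T) (hab : a ≤ b)
    (hforce : ∀ s ∈ Ioo a b, c ≤ ‖gradX E s (x s) - u s‖) :
    c * ‖x b - x a‖ ≤ dissipation T E f x u b - dissipation T E f x u a := by
  have hsub : Icc a b ⊆ Icc 0 T := Icc_subset_Icc ha.1 hb.2
  have hd := fun t ht => h.hasDerivWithinAt_dissipation hT hE hf (t := t) ht
  have hv : ContinuousOn (fun s => ‖gradX E s (x s) - u s‖) (Icc a b) := by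
    refine (ContinuousOn.sub ?_ (h.continuousOn_control.mono hsub)).norm
    exact (hE.continuousOn_gradX hT).comp (continuousOn_id.prodMk (h.continuousOn_state.mono hsub))
      (fun y hy => ⟨hsub hy, mem_univ _⟩)
  rcases hab.eq_or_lt with rfl | hlt
  · simp
  -- The lower bound passes to the endpoints by continuity, since the comparison below uses it at
  -- `a`.
  have hforce' : ∀ s ∈ Icc a b, c ≤ ‖gradX E s (x s) - u s‖ := by
    have : closure (Ioo a b) = Icc a b := closure_Ioo hlt.ne
    intro s hs
    refine ContinuousWithinAt.closure_le (s := Ioo a b) (this ▸ hs)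
      (continuousWithinAt_const (b := c)) ((hv s hs).mono Ioo_subset_Icc_self) hforce
  -- Where the force is at least `c`, the speed `ε⁻¹ |force|` is at most `c⁻¹ ε⁻¹ |force|²`, the
  -- derivative of `c⁻¹` times the dissipation.
  have key := image_norm_le_of_norm_deriv_right_le_deriv_boundary' (a := a) (b := b)
    (f := fun s => x s - x a) (f' := fun s => ε⁻¹ • (-gradX E s (x s) + u s))
    (B := fun s => c⁻¹ * (dissipation T E f x u s - dissipation T E f x u a))
    (B' := fun s => c⁻¹ * (ε⁻¹ * ‖gradX E s (x s) - u s‖ ^ 2))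
    ((h.continuousOn_state.mono hsub).sub continuousOn_const)
    (fun s hs => (hasDerivWithinAt_Ici_of_Icc (b := T) ⟨ha.1.trans hs.1, hs.2.trans_le hb.2⟩
      (h.state s (hsub (Ico_subset_Icc_self hs)))).sub_const _)
    (by simp)
    (fun s hs => (((hd s (hsub hs)).continuousWithinAt.mono hsub).sub
      continuousWithinAt_const).const_mul _)
    (fun s hs => ((hasDerivWithinAt_Ici_of_Icc (b := T) ⟨ha.1.trans hs.1, hs.2.trans_le hb.2⟩
      (hd s (hsub (Ico_subset_Icc_self hs)))).sub_const _).const_mul _)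
    (fun s hs => by
      rw [norm_velocity hε]
      have h1 := hforce' s (Ico_subset_Icc_self hs)
      rw [inv_mul_eq_div c, le_div_iff₀ hc]
      have : 0 ≤ ε⁻¹ * ‖gradX E s (x s) - u s‖ := by positivity
      nlinarith)
    (right_mem_Icc.2 hab)
  rwa [inv_mul_eq_div c, le_div_iff₀ hc, mul_comm] at key

end IsSolution

/-- Close to a given time, displacements of a given size dissipate a definite amount of energy,
uniformly along the sequence of solutions. -/
theorem exists_dissipation_ge (hT : 0 < T) (hE : IsEnergy T E) (hf : IsControlField f)
    {ε : ℕ → ℝ} (hε : ∀ n, 0 < ε n) {x₀n u₀n : ℕ → Vec d} {xn un : ℕ → ℝ → Vec d}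
    (hsol : ∀ n, IsSolution T E f (ε n) (x₀n n) (u₀n n) (xn n) (un n))
    {u : ℝ → Vec d} (hunif : TendstoUniformlyOn un u atTop (Icc 0 T))
    (hucont : ContinuousOn u (Icc 0 T)) {M : ℝ} (hM : ∀ n, ∀ t ∈ Icc 0 T, ‖xn n t‖ ≤ M)
    {t : ℝ} (ht : t ∈ Icc 0 T) {η : ℝ} (hη : 0 < η) :
    ∃ c > 0, ∃ δ > 0, ∃ N : ℕ, ∀ n ≥ N, ∀ s ∈ Icc 0 T, ∀ s' ∈ Icc 0 T, s ≤ s' →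
      |s - t| < δ → |s' - t| < δ → η ≤ ‖xn n s' - xn n s‖ →
      c ≤ dissipation T E f (xn n) (un n) s' - dissipation T E f (xn n) (un n) s := by
  suffices h : ∃ c > 0, ∃ δ > 0, ∃ N : ℕ, ∀ n ≥ N, ∀ s ∈ Icc 0 T, ∀ s' ∈ Icc 0 T, s ≤ s' →
      |s - t| < δ → |s' - t| < δ → η ≤ ‖xn n s' - xn n s‖ → xn n s ∈ Metric.closedBall 0 M →
      c ≤ dissipation T E f (xn n) (un n) s' - dissipation T E f (xn n) (un n) s by
    obtain ⟨c, hc, δ, hδ, N, h⟩ := h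
    exact ⟨c, hc, δ, hδ, N, fun n hn s hs s' hs' hss h1 h2 h3 =>
      h n hn s hs s' hs' hss h1 h2 h3 (by simpa using hM n s hs)⟩
  -- The constants depend on where the displacement starts; compactness reduces the claim to
  -- starting points in a small ball around a given `y`.
  refine (isCompact_closedBall (0 : Vec d) M).induction_on (p := fun V => ∃ c > 0, ∃ δ > 0,
    ∃ N : ℕ, ∀ n ≥ N, ∀ s ∈ Icc 0 T, ∀ s' ∈ Icc 0 T, s ≤ s' →
      |s - t| < δ → |s' - t| < δ → η ≤ ‖xn n s' - xn n s‖ → xn n s ∈ V →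
      c ≤ dissipation T E f (xn n) (un n) s' - dissipation T E f (xn n) (un n) s) ?_ ?_ ?_ ?_
  · exact ⟨1, one_pos, 1, one_pos, 0, fun n _ s _ s' _ _ _ _ _ h => absurd h (notMem_empty _)⟩
  · rintro V W hVW ⟨c, hc, δ, hδ, N, h⟩
    exact ⟨c, hc, δ, hδ, N, fun n hn s hs s' hs' hss h1 h2 h3 h4 =>
      h n hn s hs s' hs' hss h1 h2 h3 (hVW h4)⟩
  · rintro V W ⟨c, hc, δ, hδ, N, h⟩ ⟨c', hc', δ', hδ', N', h'⟩
    refine ⟨min c c', lt_min hc hc', min δ δ', lt_min hδ hδ', max N N',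
      fun n hn s hs s' hs' hss h1 h2 h3 h4 => ?_⟩
    rw [lt_min_iff] at h1 h2
    rcases h4 with h4 | h4
    · exact (min_le_left _ _).trans
        (h n ((le_max_left _ _).trans hn) s hs s' hs' hss h1.1 h2.1 h3 h4)
    · exact (min_le_right _ _).trans
        (h' n ((le_max_right _ _).trans hn) s hs s' hs' hss h1.2 h2.2 h3 h4)
  · intro y _
    obtain ⟨r, hr, hcrit⟩ := hE.exists_punctured_ball hT ht (u t) y
    -- The annulus between radii `ρ / 2` and `ρ` about `y` contains no critical point because `ρ <
    -- r`. Because `2 ρ ≤ η`, a displacement of size `η` from the inner ball must cross it.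
    set ρ := min r η / 2 with hρ
    have hρ0 : 0 < ρ := by have := lt_min hr hη; positivity
    have hρr : ρ < r := by have := min_le_left r η; have := lt_min hr hη; linarith
    have hρη : ρ ≤ η / 2 := by have := min_le_right r η; linarith
    set A := Metric.closedBall y ρ \ Metric.ball y (ρ / 2) with hA
    have hAc : IsCompact A := (isCompact_closedBall y ρ).diff Metric.isOpen_ball
    have hgc : ContinuousOn (fun z => ‖gradX E t z - u t‖) A := by
      refine (ContinuousOn.sub ?_ continuousOn_const).norm
      exact (hE.continuousOn_gradX hT).comp (continuousOn_const.prodMk continuousOn_id)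
        (fun y hy => ⟨ht, mem_univ _⟩)
    obtain ⟨c, hc, hcA⟩ := hAc.exists_forall_le' hgc (a := 0) (fun z hz => by
      rw [norm_pos_iff, sub_ne_zero]
      refine hcrit z (Metric.closedBall_subset_ball hρr hz.1) ?_
      rintro rfl
      exact hz.2 (Metric.mem_ball_self (by positivity)))
    obtain ⟨δ, hδ, N, hN⟩ := hE.exists_force_close hT hunif hucont hAc ht (half_pos hc)
    refine ⟨Metric.ball y (ρ / 2),
      mem_nhdsWithin_of_mem_nhds (Metric.ball_mem_nhds _ (by positivity)),
      c / 2 * (ρ / 2), by positivity, δ, hδ, N, fun n hn s hs s' hs' hss h1 h2 h3 h4 => ?_⟩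
    have hsub : Icc s s' ⊆ Icc 0 T := Icc_subset_Icc hs.1 hs'.2
    rw [mem_ball_iff_norm] at h4
    have h5 : ρ ≤ ‖xn n s' - y‖ := by
      have : ‖xn n s' - xn n s‖ ≤ ‖xn n s' - y‖ + ‖xn n s - y‖ := by
        have := norm_sub_le (xn n s' - y) (xn n s - y)
        rwa [sub_sub_sub_cancel_right] at this
      linarith
    obtain ⟨s₁, hs₁, s₂, hs₂, h12, e1, e2, hmid⟩ := exists_crossing hss
      (φ := fun s => ‖xn n s - y‖)
      (((hsol n).continuousOn_state.mono hsub).sub continuousOn_const).norm h4.le h5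
    have hforce : ∀ τ ∈ Ioo s₁ s₂, c / 2 ≤ ‖gradX E τ (xn n τ) - un n τ‖ := by
      intro τ hτ
      have hτ' : τ ∈ Icc s s' := ⟨hs₁.1.trans hτ.1.le, hτ.2.le.trans hs₂.2⟩
      have hzA : xn n τ ∈ A := by
        obtain ⟨g1, g2⟩ := hmid τ hτ
        refine ⟨by simpa [dist_eq_norm] using g2, by simpa [dist_eq_norm] using g1⟩
      have hτδ : |τ - t| < δ := by
        rw [abs_lt] at h1 h2 ⊢
        constructor <;> linarith [hτ'.1, hτ'.2]
      have g1 := hN n hn τ (hsub hτ') hτδ _ hzA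
      have g2 := hcA _ hzA
      have g3 := norm_sub_norm_le (gradX E t (xn n τ) - u t) (gradX E τ (xn n τ) - un n τ)
      rw [norm_sub_rev] at g1
      linarith
    have hdis := (hsol n).mul_norm_sub_le_dissipation hT hE hf (hε n) (half_pos hc)
      (hsub hs₁) (hsub hs₂) h12 hforce
    have hmono := (hsol n).monotoneOn_dissipation hT hE hf (hε n)
    have m1 := hmono hs (hsub hs₁) hs₁.1
    have m2 := hmono (hsub hs₂) hs' hs₂.2
    have h6 : ρ / 2 ≤ ‖xn n s₂ - xn n s₁‖ := by
      have := norm_sub_norm_le (xn n s₂ - y) (xn n s₁ - y)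
      rw [sub_sub_sub_cancel_right] at this
      linarith
    have h7 := mul_le_mul_of_nonneg_left h6 (half_pos hc).le
    linarith

/-! ### Sequences of solutions and their limits -/

/-- A uniformly bounded sequence of solutions with vanishing viscosities, whose controls converge
uniformly. -/
structure SolutionSeq (T : ℝ) (E : ℝ → Vec d → ℝ) (f : Vec d → Vec d) (ε : ℕ → ℝ)
    (xn un : ℕ → ℝ → Vec d) (u : ℝ → Vec d) (M U P K : ℝ) : Prop where
  pos : 0 < T
  energy : IsEnergy T E
  field : IsControlField f
  viscosity_pos : ∀ n, 0 < ε n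
  viscosity : Tendsto ε atTop (𝓝 0)
  sol : ∀ n, IsSolution T E f (ε n) (xn n 0) (un n 0) (xn n) (un n)
  unif : TendstoUniformlyOn un u atTop (Icc 0 T)
  control_cont : ContinuousOn u (Icc 0 T)
  state_le : ∀ n, ∀ t ∈ Icc 0 T, ‖xn n t‖ ≤ M
  control_le : ∀ n, ∀ t ∈ Icc 0 T, ‖un n t‖ ≤ U
  power_le : ∀ n, ∀ t ∈ Icc 0 T, |power T E f (xn n) (un n) t| ≤ P
  dissipation_le : ∀ n, ∀ t ∈ Icc 0 T, dissipation T E f (xn n) (un n) t ≤ K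

@[simp] lemma dissipation_zero (x u : ℝ → Vec d) : dissipation T E f x u 0 = 0 := by
  simp [dissipation]

/-- The dissipation, extended to the whole line by constants. -/
noncomputable def extDissipation (hT : 0 < T) (E : ℝ → Vec d → ℝ) (f : Vec d → Vec d)
    (x u : ℝ → Vec d) (t : ℝ) : ℝ :=
  dissipation T E f x u (projIcc 0 T hT.le t)

lemma extDissipation_of_mem (hT : 0 < T) (x u : ℝ → Vec d) {t : ℝ} (ht : t ∈ Icc 0 T) :
    extDissipation hT E f x u t = dissipation T E f x u t := by
  rw [extDissipation, projIcc_of_mem hT.le ht]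

namespace SolutionSeq

variable {ε : ℕ → ℝ} {xn un : ℕ → ℝ → Vec d} {u : ℝ → Vec d} {M U P K : ℝ}

lemma comp (h : SolutionSeq T E f ε xn un u M U P K) {φ : ℕ → ℕ} (hφ : StrictMono φ) :
    SolutionSeq T E f (ε ∘ φ) (xn ∘ φ) (un ∘ φ) u M U P K where
  pos := h.pos
  energy := h.energy
  field := h.field
  viscosity_pos _ := h.viscosity_pos _
  viscosity := h.viscosity.comp hφ.tendsto_atTop
  sol _ := h.sol _
  unif := fun V hV => hφ.tendsto_atTop.eventually (h.unif V hV)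
  control_cont := h.control_cont
  state_le _ := h.state_le _
  control_le _ := h.control_le _
  power_le _ := h.power_le _
  dissipation_le _ := h.dissipation_le _

lemma monotone_extDissipation (h : SolutionSeq T E f ε xn un u M U P K) (n : ℕ) :
    Monotone (extDissipation h.pos E f (xn n) (un n)) := fun s t hst =>
  (h.sol n).monotoneOn_dissipation h.pos h.energy h.field (h.viscosity_pos n)
    (projIcc 0 T h.pos.le s).2 (projIcc 0 T h.pos.le t).2 (monotone_projIcc h.pos.le hst)

lemma extDissipation_mem (h : SolutionSeq T E f ε xn un u M U P K) (n : ℕ) (t : ℝ) :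
    extDissipation h.pos E f (xn n) (un n) t ∈ Icc 0 K := by
  refine ⟨?_, h.dissipation_le n _ (projIcc 0 T h.pos.le t).2⟩
  have := (h.sol n).monotoneOn_dissipation h.pos h.energy h.field (h.viscosity_pos n)
    (left_mem_Icc.2 h.pos.le) (projIcc 0 T h.pos.le t).2 (projIcc 0 T h.pos.le t).2.1
  rwa [dissipation_zero] at this

/-- At continuity points of the limit dissipation the solutions are equicontinuous. -/
lemma exists_equicontinuous (h : SolutionSeq T E f ε xn un u M U P K) {G : ℝ → ℝ}
    (hG : ∀ t, Tendsto (fun n => extDissipation h.pos E f (xn n) (un n) t) atTop (𝓝 (G t)))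
    {t : ℝ} (ht : t ∈ Icc 0 T) (hGt : ContinuousAt G t) {η : ℝ} (hη : 0 < η) :
    ∃ δ > 0, ∃ N : ℕ, ∀ n ≥ N, ∀ s ∈ Icc 0 T, ∀ s' ∈ Icc 0 T,
      |s - t| < δ → |s' - t| < δ → ‖xn n s' - xn n s‖ < η := by
  obtain ⟨c, hc, δ, hδ, N, hN⟩ := exists_dissipation_ge h.pos h.energy h.field h.viscosity_pos
    h.sol h.unif h.control_cont h.state_le ht hη
  obtain ⟨δ', hδ', hGδ⟩ := Metric.continuousAt_iff.1 hGt (c / 2) (by positivity)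
  set r := min δ δ' / 2 with hr
  have hr0 : 0 < r := by have := lt_min hδ hδ'; positivity
  have hrδ : r < δ := by have := min_le_left δ δ'; linarith
  have hrδ' : r < δ' := by have := min_le_right δ δ'; linarith
  -- Continuity of `G` leaves less than `c` to dissipate on `[t - r, t + r]`, and this passes to the
  -- approximations for large `n`.
  have hlt : G (t + r) - G (t - r) < c := by
    have h1 := hGδ (x := t + r) (by simp [abs_of_pos hr0, hrδ'])
    have h2 := hGδ (x := t - r) (by simp [abs_of_pos hr0, hrδ'])
    rw [Real.dist_eq, abs_lt] at h1 h2
    linarith [h1.2, h2.1]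
  obtain ⟨N', hN'⟩ := eventually_atTop.1 (((hG (t + r)).sub (hG (t - r))).eventually_lt_const hlt)
  refine ⟨r, hr0, max N N', fun n hn => ?_⟩
  have key : ∀ s ∈ Icc 0 T, ∀ s' ∈ Icc 0 T, s ≤ s' → |s - t| < r → |s' - t| < r →
      ‖xn n s' - xn n s‖ < η := by
    intro s hs s' hs' hss h1 h2
    by_contra! hge
    have h3 := hN n ((le_max_left _ _).trans hn) s hs s' hs' hss (h1.trans hrδ) (h2.trans hrδ) hge
    have h4 := hN' n ((le_max_right _ _).trans hn)
    rw [abs_lt] at h1 h2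
    have h5 := h.monotone_extDissipation n (show t - r ≤ s by linarith)
    have h6 := h.monotone_extDissipation n (show s' ≤ t + r by linarith)
    rw [extDissipation_of_mem h.pos _ _ hs] at h5
    rw [extDissipation_of_mem h.pos _ _ hs'] at h6
    linarith
  intro s hs s' hs' h1 h2
  rcases le_total s s' with hss | hss
  · exact key s hs s' hs' hss h1 h2
  · rw [norm_sub_rev]
    exact key s' hs' s hs hss h2 h1

/-- Compactness: pointwise convergence of the states and of the dissipations along a
subsequence. -/
theorem exists_subseq (h : SolutionSeq T E f ε xn un u M U P K) :
    ∃ φ : ℕ → ℕ, StrictMono φ ∧ ∃ (x : ℝ → Vec d) (G : ℝ → ℝ), Monotone G ∧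
      (∀ t, Tendsto (fun k => extDissipation h.pos E f (xn (φ k)) (un (φ k)) t) atTop (𝓝 (G t))) ∧
      (∀ t ∈ Icc 0 T, Tendsto (fun k => xn (φ k) t) atTop (𝓝 (x t))) := by
  obtain ⟨φ, hφ, G, hGmono, hG⟩ := exists_subseq_tendsto_of_monotone h.monotone_extDissipation
    h.extDissipation_mem
  have h' := h.comp hφ
  -- The times at which compactness is used directly: the jumps of `G`, and the rationals projected
  -- to `[0,T]`, which are dense there.
  set S : Set ℝ := ({t | ¬ContinuousAt G t} ∩ Icc 0 T) ∪
    range (fun q : ℚ => (projIcc 0 T h.pos.le (q : ℝ) : ℝ)) with hS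
  have hSc : S.Countable := (hGmono.countable_not_continuousAt.mono inter_subset_left).union
    (countable_range _)
  have hSI : S ⊆ Icc 0 T := by
    rintro s (⟨-, hs⟩ | ⟨q, rfl⟩)
    exacts [hs, (projIcc 0 T h.pos.le _).2]
  obtain ⟨ψ, hψ, hlim⟩ := exists_subseq_tendsto_of_countable (isCompact_closedBall (0 : Vec d) M)
    hSc (xn ∘ φ) (fun n s hs => by simpa using h'.state_le n s (hSI hs))
  have hG' : ∀ t, Tendsto (fun k => extDissipation h.pos E f (xn (φ (ψ k))) (un (φ (ψ k))) t) atTop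
      (𝓝 (G t)) := fun t => (hG t).comp hψ.tendsto_atTop
  have h'' := h'.comp hψ
  have hall : ∀ t ∈ Icc 0 T, ∃ y, Tendsto (fun k => xn (φ (ψ k)) t) atTop (𝓝 y) := by
    intro t ht
    by_cases hGt : ContinuousAt G t
    -- At a continuity point, equicontinuity transfers the Cauchy property from a nearby time `p` in
    -- the dense set.
    · refine cauchySeq_tendsto_of_complete (Metric.cauchySeq_iff.2 fun η hη => ?_)
      obtain ⟨δ, hδ, N, hN⟩ := h''.exists_equicontinuous hG' ht hGt (η := η / 3) (by positivity)
      obtain ⟨q, hq1, hq2⟩ := exists_rat_btwn (show t - δ < t by linarith)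
      set p : ℝ := ((projIcc 0 T h.pos.le (q : ℝ) : Icc 0 T) : ℝ) with hp
      have hpI : p ∈ Icc 0 T := (projIcc 0 T h.pos.le _).2
      have hpt : |p - t| < δ := by
        have h1 : p ≤ t := by
          have := monotone_projIcc h.pos.le hq2.le
          rw [projIcc_of_mem h.pos.le ht] at this
          exact this
        have h2 : (q : ℝ) ≤ p := by
          rw [hp, coe_projIcc]
          exact le_max_of_le_right (le_min (hq2.le.trans ht.2) le_rfl)
        rw [abs_lt]; constructor <;> linarith
      obtain ⟨y, -, hy⟩ := hlim p (Or.inr ⟨q, rfl⟩)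
      obtain ⟨N', hN'⟩ := Metric.cauchySeq_iff.1 hy.cauchySeq (η / 3) (by positivity)
      refine ⟨max N N', fun m hm n hn => ?_⟩
      have e1 := hN m ((le_max_left _ _).trans hm) p hpI t ht hpt (by simpa using hδ)
      have e2 := hN n ((le_max_left _ _).trans hn) t ht p hpI (by simpa using hδ) hpt
      have e3 := hN' m ((le_max_right _ _).trans hm) n ((le_max_right _ _).trans hn)
      simp only [Function.comp_apply, dist_eq_norm] at e1 e2 e3 ⊢
      have e4 : xn (φ (ψ m)) t - xn (φ (ψ n)) t = (xn (φ (ψ m)) t - xn (φ (ψ m)) p) +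
        (xn (φ (ψ m)) p - xn (φ (ψ n)) p) + (xn (φ (ψ n)) p - xn (φ (ψ n)) t) := by abel
      rw [e4]
      refine (norm_add₃_le).trans_lt ?_
      linarith
    · obtain ⟨y, -, hy⟩ := hlim t (Or.inl ⟨hGt, ht⟩)
      exact ⟨y, hy⟩
  choose! x hx using hall
  exact ⟨φ ∘ ψ, hφ.comp hψ, x, G, hGmono, hG', hx⟩

end SolutionSeq

/-- A sequence of solutions whose states and dissipations converge pointwise, to `x` and `G`. -/
structure ConvergentSolutionSeq (T : ℝ) (E : ℝ → Vec d → ℝ) (f : Vec d → Vec d) (ε : ℕ → ℝ)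
    (xn un : ℕ → ℝ → Vec d) (u : ℝ → Vec d) (M U P K : ℝ) (x : ℝ → Vec d) (G : ℝ → ℝ) : Prop
    extends SolutionSeq T E f ε xn un u M U P K where
  mono : Monotone G
  tendsto_dissipation : ∀ t,
    Tendsto (fun n => extDissipation pos E f (xn n) (un n) t) atTop (𝓝 (G t))
  tendsto_state : ∀ t ∈ Icc 0 T, Tendsto (fun n => xn n t) atTop (𝓝 (x t))

/-- A time subset of full measure accumulates from both sides. -/
lemma frequently_nhdsLT_of_ae {p : ℝ → Prop} {t : ℝ} (ht : t ∈ Ioc 0 T)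
    (hp : ∀ᵐ s, s ∈ Icc 0 T → p s) : ∃ᶠ s in 𝓝[<] t, p s := by
  intro hcon
  obtain ⟨a, ha, hsub⟩ := (mem_nhdsLT_iff_exists_Ioo_subset' ht.1).1 hcon
  have h0 : volume (Ioo (max a 0) t) = 0 := by
    refine measure_mono_null (fun s hs => ?_) hp
    intro hps
    exact hsub ⟨(le_max_left _ _).trans_lt hs.1, hs.2⟩
      (hps ⟨((le_max_right _ _).trans_lt hs.1).le, hs.2.le.trans ht.2⟩)
  rw [Real.volume_Ioo, ENNReal.ofReal_eq_zero, sub_nonpos] at h0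
  exact absurd h0 (not_le.2 (max_lt ha ht.1))

lemma frequently_nhdsGT_of_ae {p : ℝ → Prop} {t : ℝ} (ht : t ∈ Ico 0 T)
    (hp : ∀ᵐ s, s ∈ Icc 0 T → p s) : ∃ᶠ s in 𝓝[>] t, p s := by
  intro hcon
  obtain ⟨b, hb, hsub⟩ := (mem_nhdsGT_iff_exists_Ioo_subset' ht.2).1 hcon
  have h0 : volume (Ioo t (min b T)) = 0 := by
    refine measure_mono_null (fun s hs => ?_) hp
    intro hps
    exact hsub ⟨hs.1, hs.2.trans_le (min_le_left _ _)⟩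
      (hps ⟨ht.1.trans hs.1.le, (hs.2.trans_le (min_le_right _ _)).le⟩)
  rw [Real.volume_Ioo, ENNReal.ofReal_eq_zero, sub_nonpos] at h0
  exact absurd h0 (not_le.2 (lt_min hb ht.2))

/-! ### Criticality and one-sided limits of the limit state -/

namespace ConvergentSolutionSeq

variable {ε : ℕ → ℝ} {xn un : ℕ → ℝ → Vec d} {u : ℝ → Vec d} {M U P K : ℝ} {x : ℝ → Vec d}
  {G : ℝ → ℝ}

lemma norm_state_le (h : ConvergentSolutionSeq T E f ε xn un u M U P K x G) {t : ℝ}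
    (ht : t ∈ Icc 0 T) : ‖x t‖ ≤ M :=
  le_of_tendsto' (h.tendsto_state t ht).norm (fun n => h.state_le n t ht)

lemma tendsto_control (h : ConvergentSolutionSeq T E f ε xn un u M U P K x G) {t : ℝ}
    (ht : t ∈ Icc 0 T) : Tendsto (fun n => un n t) atTop (𝓝 (u t)) :=
  h.unif.tendsto_at ht

lemma aestronglyMeasurable_state (h : ConvergentSolutionSeq T E f ε xn un u M U P K x G) :
    AEStronglyMeasurable x (volume.restrict (Icc 0 T)) :=
  aestronglyMeasurable_of_tendsto_ae atTop
    (fun n => (h.sol n).continuousOn_state.aestronglyMeasurable measurableSet_Icc)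
    ((ae_restrict_iff' measurableSet_Icc).2 (Eventually.of_forall h.tendsto_state))

lemma tendsto_slice {g : ℝ × Vec d → ℝ} {g' : ℝ × Vec d → Vec d}
    (hg : ContinuousOn g (Icc 0 T ×ˢ univ)) (hg' : ContinuousOn g' (Icc 0 T ×ˢ univ))
    {t : ℝ} (ht : t ∈ Icc 0 T) {ι : Type*} {l : Filter ι} {s : ι → ℝ} {y : ι → Vec d} {y₀ : Vec d}
    (hs : Tendsto s l (𝓝 t)) (hs' : ∀ᶠ i in l, s i ∈ Icc 0 T) (hy : Tendsto y l (𝓝 y₀)) :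
    Tendsto (fun i => g (s i, y i)) l (𝓝 (g (t, y₀))) ∧
      Tendsto (fun i => g' (s i, y i)) l (𝓝 (g' (t, y₀))) := by
  have : Tendsto (fun i => (s i, y i)) l (𝓝[Icc 0 T ×ˢ univ] (t, y₀)) :=
    tendsto_nhdsWithin_iff.2 ⟨hs.prodMk_nhds hy, hs'.mono fun i hi => ⟨hi, mem_univ _⟩⟩
  exact ⟨(hg _ ⟨ht, mem_univ _⟩).tendsto.comp this, (hg' _ ⟨ht, mem_univ _⟩).tendsto.comp this⟩

lemma tendsto_power (h : ConvergentSolutionSeq T E f ε xn un u M U P K x G) {t : ℝ}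
    (ht : t ∈ Icc 0 T) :
    Tendsto (fun n => power T E f (xn n) (un n) t) atTop (𝓝 (power T E f x u t)) := by
  have h1 := (tendsto_slice (h.energy.continuousOn_partialT h.pos)
    (h.energy.continuousOn_gradX h.pos) ht tendsto_const_nhds (Eventually.of_forall fun _ => ht)
    (h.tendsto_state t ht)).1
  have h2 := (h.field.locallyLipschitz.continuous.tendsto _).comp (h.tendsto_control ht)
  exact h1.sub (h2.inner (h.tendsto_state t ht))

lemma tendsto_force (h : ConvergentSolutionSeq T E f ε xn un u M U P K x G) {t : ℝ}
    (ht : t ∈ Icc 0 T) : Tendsto (fun n => gradX E t (xn n t) - un n t) atTop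
      (𝓝 (gradX E t (x t) - u t)) :=
  (tendsto_slice (h.energy.continuousOn_partialT h.pos)
    (h.energy.continuousOn_gradX h.pos) ht tendsto_const_nhds (Eventually.of_forall fun _ => ht)
    (h.tendsto_state t ht)).2.sub (h.tendsto_control ht)

lemma tendsto_corrEnergy_of_tendsto (h : ConvergentSolutionSeq T E f ε xn un u M U P K x G)
    {t : ℝ} (ht : t ∈ Icc 0 T) {ι : Type*} {l : Filter ι} {s : ι → ℝ} {y v : ι → Vec d}
    {y₀ v₀ : Vec d} (hs : Tendsto s l (𝓝 t)) (hs' : ∀ᶠ i in l, s i ∈ Icc 0 T)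
    (hy : Tendsto y l (𝓝 y₀)) (hv : Tendsto v l (𝓝 v₀)) :
    Tendsto (fun i => corrEnergy E (s i) (y i) (v i)) l (𝓝 (corrEnergy E t y₀ v₀)) :=
  (tendsto_slice h.energy.continuousOn_uncurry
    (h.energy.continuousOn_gradX h.pos) ht hs hs' hy).1.sub (hv.inner hy)

lemma continuousOn_power_seq (h : ConvergentSolutionSeq T E f ε xn un u M U P K x G) (n : ℕ) :
    ContinuousOn (power T E f (xn n) (un n)) (Icc 0 T) :=
  continuousOn_power h.pos h.energy h.field (h.sol n).continuousOn_state
    (h.sol n).continuousOn_control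

lemma integrableOn_power (h : ConvergentSolutionSeq T E f ε xn un u M U P K x G) :
    IntegrableOn (power T E f x u) (Icc 0 T) := by
  refine Integrable.of_bound (μ := volume.restrict (Icc 0 T)) ?_ P ?_
  · exact aestronglyMeasurable_of_tendsto_ae atTop
      (fun n => (h.continuousOn_power_seq n).aestronglyMeasurable measurableSet_Icc)
      ((ae_restrict_iff' measurableSet_Icc).2 (Eventually.of_forall fun t ht => h.tendsto_power ht))
  · exact (ae_restrict_iff' measurableSet_Icc).2 (Eventually.of_forall fun t ht =>
      le_of_tendsto' (h.tendsto_power ht).norm (fun n => h.power_le n t ht))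

/-- The limit dissipation is the dissipation of the limit. -/
lemma eq_dissipation (h : ConvergentSolutionSeq T E f ε xn un u M U P K x G) {t : ℝ}
    (ht : t ∈ Icc 0 T) : G t = dissipation T E f x u t := by
  have h0 : (0 : ℝ) ∈ Icc 0 T := left_mem_Icc.2 h.pos.le
  refine tendsto_nhds_unique (h.tendsto_dissipation t) ?_
  simp only [extDissipation_of_mem h.pos _ _ ht]
  have hsub : uIoc 0 t ⊆ Icc 0 T := by
    rw [uIoc_of_le ht.1]; exact fun s hs => ⟨hs.1.le, hs.2.trans ht.2⟩
  refine ((h.tendsto_corrEnergy_of_tendsto h0 tendsto_const_nhds (Eventually.of_forall fun _ => h0)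
    (h.tendsto_state 0 h0) (h.tendsto_control h0)).sub
    (h.tendsto_corrEnergy_of_tendsto ht tendsto_const_nhds (Eventually.of_forall fun _ => ht)
    (h.tendsto_state t ht) (h.tendsto_control ht))).add ?_
  refine intervalIntegral.tendsto_integral_filter_of_dominated_convergence (fun _ => P)
    (Eventually.of_forall fun n =>
      ((h.continuousOn_power_seq n).mono hsub).aestronglyMeasurable measurableSet_uIoc)
    (Eventually.of_forall fun n => Eventually.of_forall fun s hs => h.power_le n s (hsub hs))
    intervalIntegrable_const (Eventually.of_forall fun s hs => h.tendsto_power (hsub hs))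

/-- Makes the left limit of `G` at `0` equal to `G 0`, in agreement with the convention `x₋(0) =
x(0)`; `G_of_ge` plays the same role at `T`. -/
lemma G_of_le (h : ConvergentSolutionSeq T E f ε xn un u M U P K x G) {t : ℝ} (ht : t ≤ 0) :
    G t = G 0 := by
  refine tendsto_nhds_unique (h.tendsto_dissipation t) ?_
  have := h.tendsto_dissipation 0
  unfold extDissipation at this ⊢
  rwa [projIcc_of_le_left _ ht, ← projIcc_of_le_left h.pos.le le_rfl]

lemma G_of_ge (h : ConvergentSolutionSeq T E f ε xn un u M U P K x G) {t : ℝ} (ht : T ≤ t) :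
    G t = G T := by
  refine tendsto_nhds_unique (h.tendsto_dissipation t) ?_
  have := h.tendsto_dissipation T
  unfold extDissipation at this ⊢
  rwa [projIcc_of_right_le _ ht, ← projIcc_of_right_le h.pos.le le_rfl]

/-- The limit state is critical at almost every time. -/
lemma ae_mem_critSet (h : ConvergentSolutionSeq T E f ε xn un u M U P K x G) :
    ∀ᵐ t, t ∈ Icc 0 T → x t ∈ critSet E t (u t) := by
  have hT := h.pos.le
  have hvc : ∀ n, ContinuousOn (fun t => ‖gradX E t (xn n t) - un n t‖ ^ 2) (Icc 0 T) := fun n =>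
    ((((h.energy.continuousOn_gradX h.pos).comp
      (continuousOn_id.prodMk (h.sol n).continuousOn_state)
      (fun y hy => ⟨hy, mem_univ _⟩)).sub (h.sol n).continuousOn_control).norm).pow 2
  -- Since the dissipations stay bounded, this identity makes the force vanish in the mean square as
  -- `ε n → 0`.
  have hint : ∀ n, ∫ t in (0 : ℝ)..T, ‖gradX E t (xn n t) - un n t‖ ^ 2 =
      ε n * dissipation T E f (xn n) (un n) T := by
    intro n
    have hd := fun t ht => (h.sol n).hasDerivWithinAt_dissipation h.pos h.energy h.field
      (t := t) ht
    have := intervalIntegral.integral_eq_sub_of_hasDerivAt_of_le hT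
      (f := dissipation T E f (xn n) (un n))
      (fun t ht => (hd t ht).continuousWithinAt)
      (fun t ht => hasDerivAt_of_Icc ht (hd t (Ioo_subset_Icc_self ht)))
      (ContinuousOn.intervalIntegrable (by
        rw [uIcc_of_le hT]; exact continuousOn_const.mul (hvc n)))
    rw [intervalIntegral.integral_const_mul, dissipation_zero, sub_zero] at this
    rw [← this, ← mul_assoc, mul_inv_cancel₀ (h.viscosity_pos n).ne', one_mul]
  obtain ⟨C, hC⟩ :=
    (isCompact_Icc.prod (isCompact_closedBall (0 : Vec d) M)).exists_bound_of_continuousOn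
    ((h.energy.continuousOn_gradX h.pos).mono (prod_mono_right (subset_univ _)))
  have hbound : ∀ n, ∀ t ∈ Icc 0 T, ‖gradX E t (xn n t) - un n t‖ ^ 2 ≤ (C + U) ^ 2 := by
    intro n t ht
    have h1 := hC (t, xn n t) ⟨ht, by simpa using h.state_le n t ht⟩
    have h2 := (norm_sub_le (gradX E t (xn n t)) (un n t)).trans
      (add_le_add h1 (h.control_le n t ht))
    gcongr
  have hsub : uIoc 0 T ⊆ Icc 0 T := by
    rw [uIoc_of_le hT]; exact Ioc_subset_Icc_self
  have hlim : Tendsto (fun n => ∫ t in (0 : ℝ)..T, ‖gradX E t (xn n t) - un n t‖ ^ 2) atTop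
      (𝓝 (∫ t in (0 : ℝ)..T, ‖gradX E t (x t) - u t‖ ^ 2)) :=
    intervalIntegral.tendsto_integral_filter_of_dominated_convergence (fun _ => (C + U) ^ 2)
      (Eventually.of_forall fun n => ((hvc n).mono hsub).aestronglyMeasurable measurableSet_uIoc)
      (Eventually.of_forall fun n => Eventually.of_forall fun s hs => by
        rw [Real.norm_of_nonneg (by positivity)]; exact hbound n s (hsub hs))
      intervalIntegrable_const
      (Eventually.of_forall fun s hs => ((h.tendsto_force (hsub hs)).norm.pow 2))
  have hlim0 : Tendsto (fun n => ∫ t in (0 : ℝ)..T, ‖gradX E t (xn n t) - un n t‖ ^ 2) atTop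
      (𝓝 0) := by
    have h1 : Tendsto (fun n => ε n * dissipation T E f (xn n) (un n) T) atTop (𝓝 (0 * G T)) := by
      refine h.viscosity.mul ?_
      have := h.tendsto_dissipation T
      simpa only [extDissipation_of_mem h.pos _ _ (right_mem_Icc.2 hT)] using this
    rw [zero_mul] at h1
    simpa only [hint] using h1
  have hzero := tendsto_nhds_unique hlim hlim0
  have hmeas : AEStronglyMeasurable (fun t => ‖gradX E t (x t) - u t‖ ^ 2)
      (volume.restrict (Icc 0 T)) :=
    aestronglyMeasurable_of_tendsto_ae atTop
      (fun n => (hvc n).aestronglyMeasurable measurableSet_Icc)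
      ((ae_restrict_iff' measurableSet_Icc).2
        (Eventually.of_forall fun t ht => (h.tendsto_force ht).norm.pow 2))
  have hInt : IntegrableOn (fun t => ‖gradX E t (x t) - u t‖ ^ 2) (Icc 0 T) := by
    refine Integrable.of_bound hmeas ((C + U) ^ 2) ?_
    refine (ae_restrict_iff' measurableSet_Icc).2 (Eventually.of_forall fun t ht => ?_)
    rw [Real.norm_of_nonneg (by positivity)]
    exact le_of_tendsto' ((h.tendsto_force ht).norm.pow 2) (fun n => hbound n t ht)
  rw [intervalIntegral.integral_of_le hT, ← integral_Icc_eq_integral_Ioc,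
    integral_eq_zero_iff_of_nonneg (fun t => by positivity) hInt] at hzero
  have := (ae_restrict_iff' measurableSet_Icc).1 hzero
  filter_upwards [this] with t ht htI
  have h1 : gradX E t (x t) = u t := by simpa [sub_eq_zero] using ht htI
  exact h1

/-- Displacements of the limit cost a definite amount of the limit dissipation. -/
lemma exists_G_sub_ge (h : ConvergentSolutionSeq T E f ε xn un u M U P K x G) {t : ℝ}
    (ht : t ∈ Icc 0 T) {η : ℝ} (hη : 0 < η) :
    ∃ c > 0, ∃ δ > 0, ∀ s ∈ Icc 0 T, ∀ s' ∈ Icc 0 T, s ≤ s' → |s - t| < δ → |s' - t| < δ →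
      η < ‖x s' - x s‖ → c ≤ G s' - G s := by
  obtain ⟨c, hc, δ, hδ, N, hN⟩ := exists_dissipation_ge h.pos h.energy h.field h.viscosity_pos
    h.sol h.unif h.control_cont h.state_le ht hη
  refine ⟨c, hc, δ, hδ, fun s hs s' hs' hss h1 h2 h3 => ?_⟩
  have h4 := (((h.tendsto_state s' hs').sub (h.tendsto_state s hs)).norm).eventually_const_lt h3
  refine ge_of_tendsto ((h.tendsto_dissipation s').sub (h.tendsto_dissipation s)) ?_
  filter_upwards [h4, eventually_ge_atTop N] with n hn hnN
  rw [extDissipation_of_mem h.pos _ _ hs, extDissipation_of_mem h.pos _ _ hs']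
  exact hN n hnN s hs s' hs' hss h1 h2 hn.le

/-- Along a filter on which the limit dissipation converges, so does the limit state. -/
lemma exists_tendsto_of_tendsto_G (h : ConvergentSolutionSeq T E f ε xn un u M U P K x G) {t : ℝ}
    (ht : t ∈ Icc 0 T) {l : Filter ℝ} [l.NeBot] (hl : l ≤ 𝓝[Icc 0 T] t) {γ : ℝ}
    (hG : Tendsto G l (𝓝 γ)) : ∃ y, Tendsto x l (𝓝 y) := by
  refine cauchy_map_iff_exists_tendsto.1 (Metric.cauchy_iff.2 ⟨inferInstance, fun η hη => ?_⟩)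
  -- Cauchy criterion: once `G` is within `c / 2` of `γ`, two of its values differ by less than `c`,
  -- too little to pay for a displacement larger than `η / 2`.
  obtain ⟨c, hc, δ, hδ, hcδ⟩ := h.exists_G_sub_ge ht (half_pos hη)
  have h1 : ∀ᶠ s in l, s ∈ Icc 0 T := hl self_mem_nhdsWithin
  have h2 : ∀ᶠ s in l, |s - t| < δ := by
    have : ∀ᶠ s in 𝓝 t, |s - t| < δ := Metric.ball_mem_nhds t hδ
    exact hl (nhdsWithin_le_nhds this)
  have h3 : ∀ᶠ s in l, |G s - γ| < c / 2 := hG (Metric.ball_mem_nhds γ (half_pos hc))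
  refine ⟨_, image_mem_map (h1.and (h2.and h3)), ?_⟩
  have key : ∀ s s' : ℝ, s ∈ Icc 0 T → s' ∈ Icc 0 T → |s - t| < δ → |s' - t| < δ →
      |G s - γ| < c / 2 → |G s' - γ| < c / 2 → s ≤ s' → ‖x s' - x s‖ ≤ η / 2 := by
    intro s s' a1 a2 b1 b2 c1 c2 hss
    by_contra! hlt
    have := hcδ s a1 s' a2 hss b1 b2 hlt
    rw [abs_lt] at c1 c2
    linarith [c1.1, c2.2]
  rintro _ ⟨s, ⟨a1, b1, c1⟩, rfl⟩ _ ⟨s', ⟨a2, b2, c2⟩, rfl⟩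
  rw [dist_eq_norm]
  rcases le_total s s' with hss | hss
  · rw [norm_sub_rev]
    linarith [key s s' a1 a2 b1 b2 c1 c2 hss]
  · linarith [key s' s a2 a1 b2 b1 c2 c1 hss]

/-- The force is jointly continuous in time and state, so its zero set is closed. Frequent
criticality suffices because `x` converges along all of `l`; this matters since `x` is only known to
be critical at almost every time. -/
lemma mem_critSet_of_tendsto (h : ConvergentSolutionSeq T E f ε xn un u M U P K x G) {t : ℝ}
    (ht : t ∈ Icc 0 T) {l : Filter ℝ} (hl : l ≤ 𝓝[Icc 0 T] t) {y : Vec d}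
    (hy : Tendsto x l (𝓝 y)) (hfreq : ∃ᶠ s in l, x s ∈ critSet E s (u s)) :
    y ∈ critSet E t (u t) := by
  have hl' : Tendsto (fun s => s) l (𝓝[Icc 0 T] t) := hl
  have h1 := (tendsto_slice (h.energy.continuousOn_partialT h.pos)
    (h.energy.continuousOn_gradX h.pos) ht (tendsto_nhdsWithin_iff.1 hl').1
    (tendsto_nhdsWithin_iff.1 hl').2 hy).2
  have h2 : Tendsto u l (𝓝 (u t)) := (h.control_cont t ht).tendsto.comp hl'
  have h3 : gradX E t y - u t ∈ ({0} : Set (Vec d)) :=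
    isClosed_singleton.mem_of_frequently_of_tendsto
      (hfreq.mono fun s hs => sub_eq_zero.2 hs) (h1.sub h2)
  exact sub_eq_zero.1 h3

lemma nhdsLT_le {t : ℝ} (ht : t ∈ Ioc 0 T) : 𝓝[<] t ≤ 𝓝[Icc 0 T] t :=
  nhdsWithin_le_of_mem (mem_of_superset (Ioo_mem_nhdsLT ht.1)
    fun _ hs => ⟨hs.1.le, hs.2.le.trans ht.2⟩)

lemma nhdsGT_le {t : ℝ} (ht : t ∈ Ico 0 T) : 𝓝[>] t ≤ 𝓝[Icc 0 T] t :=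
  nhdsWithin_le_of_mem (mem_of_superset (Ioo_mem_nhdsGT ht.2)
    fun _ hs => ⟨ht.1.trans hs.1.le, hs.2.le⟩)

lemma exists_oneSidedLimits (h : ConvergentSolutionSeq T E f ε xn un u M U P K x G) :
    ∃ xm xp : ℝ → Vec d, IsOneSidedLimits T x xm xp ∧
      (∀ t ∈ Ioc 0 T, xm t ∈ critSet E t (u t)) ∧
      (∀ t ∈ Ico 0 T, xp t ∈ critSet E t (u t)) := by
  have hl : ∀ t ∈ Ioc 0 T, ∃ y, Tendsto x (𝓝[<] t) (𝓝 y) := fun t ht =>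
    h.exists_tendsto_of_tendsto_G (Ioc_subset_Icc_self ht) (nhdsLT_le ht) (h.mono.tendsto_leftLim t)
  have hr : ∀ t ∈ Ico 0 T, ∃ y, Tendsto x (𝓝[>] t) (𝓝 y) := fun t ht =>
    h.exists_tendsto_of_tendsto_G (Ico_subset_Icc_self ht) (nhdsGT_le ht)
      (h.mono.tendsto_rightLim t)
  choose! ym hym using hl
  choose! yp hyp using hr
  have hm : ∀ t ∈ Ioc 0 T, Function.update ym 0 (x 0) t = ym t := fun t ht =>
    Function.update_of_ne ht.1.ne' _ _
  have hp : ∀ t ∈ Ico 0 T, Function.update yp T (x T) t = yp t := fun t ht =>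
    Function.update_of_ne ht.2.ne _ _
  refine ⟨Function.update ym 0 (x 0), Function.update yp T (x T), ⟨fun t ht => ?_, fun t ht => ?_,
    Function.update_self _ _ _, Function.update_self _ _ _⟩, fun t ht => ?_, fun t ht => ?_⟩
  · rw [hm t ht]; exact hym t ht
  · rw [hp t ht]; exact hyp t ht
  · rw [hm t ht]
    exact h.mem_critSet_of_tendsto (Ioc_subset_Icc_self ht) (nhdsLT_le ht) (hym t ht)
      (frequently_nhdsLT_of_ae ht h.ae_mem_critSet)
  · rw [hp t ht]
    exact h.mem_critSet_of_tendsto (Ico_subset_Icc_self ht) (nhdsGT_le ht) (hyp t ht)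
      (frequently_nhdsGT_of_ae ht h.ae_mem_critSet)

end ConvergentSolutionSeq

namespace ConvergentSolutionSeq

variable {ε : ℕ → ℝ} {xn un : ℕ → ℝ → Vec d} {u : ℝ → Vec d} {M U P K : ℝ} {x : ℝ → Vec d}
  {G : ℝ → ℝ}

/-! ### The dissipation measure -/

/-- The measure on `[0,T]` with distribution function `G`. -/
noncomputable def defectMeasure (T : ℝ) {G : ℝ → ℝ} (hG : Monotone G) : Measure ℝ :=
  hG.stieltjesFunction.measure.restrict (Icc 0 T)

lemma defectMeasure_Icc (hG : Monotone G) {s t : ℝ} (hs : s ∈ Icc 0 T) (ht : t ∈ Icc 0 T) :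
    defectMeasure T hG (Icc s t) =
      ENNReal.ofReal (Function.rightLim G t - Function.leftLim G s) := by
  rw [defectMeasure, Measure.restrict_apply measurableSet_Icc,
    inter_eq_left.2 (Icc_subset_Icc hs.1 ht.2), StieltjesFunction.measure_Icc,
    hG.stieltjesFunction_eq]
  -- The Stieltjes function is the right-continuous version of `G`, which has the same left limits
  -- as `G`.
  congr 2
  exact leftLim_rightLim (hG.tendsto_leftLim s)

lemma defectMeasure_singleton (hG : Monotone G) {t : ℝ} (ht : t ∈ Icc 0 T) :
    defectMeasure T hG {t} =
      ENNReal.ofReal (Function.rightLim G t - Function.leftLim G t) := by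
  rw [← Icc_self, defectMeasure_Icc hG ht ht]

lemma isFiniteMeasure_defectMeasure (hG : Monotone G) : IsFiniteMeasure (defectMeasure T hG) := by
  refine ⟨?_⟩
  rw [defectMeasure, Measure.restrict_apply_univ, StieltjesFunction.measure_Icc]
  exact ENNReal.ofReal_lt_top

lemma defectMeasure_compl (hG : Monotone G) : defectMeasure T hG (Icc 0 T)ᶜ = 0 := by
  rw [defectMeasure, Measure.restrict_apply measurableSet_Icc.compl, compl_inter_self,
    measure_empty]

lemma atomSet_eq (hG : Monotone G) :
    atomSet T (defectMeasure T hG) = {t | t ∈ Icc 0 T ∧ ¬ ContinuousAt G t} := by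
  ext t
  refine and_congr_right fun ht => ?_
  rw [defectMeasure_singleton hG ht, ENNReal.ofReal_pos, sub_pos,
    hG.continuousAt_iff_leftLim_eq_rightLim]
  exact lt_iff_le_and_ne.trans (and_iff_right (hG.leftLim_le_rightLim le_rfl))

lemma tendsto_integral_power (h : ConvergentSolutionSeq T E f ε xn un u M U P K x G) {t : ℝ}
    (ht : t ∈ Icc 0 T) {l : Filter ℝ} (hl : l ≤ 𝓝[Icc 0 T] t) :
    Tendsto (fun s => ∫ τ in (0 : ℝ)..s, power T E f x u τ) l
      (𝓝 (∫ τ in (0 : ℝ)..t, power T E f x u τ)) := by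
  have hc := intervalIntegral.continuousOn_primitive_interval (μ := volume) (a := 0) (b := T)
    (f := power T E f x u) (by rw [uIcc_of_le h.pos.le]; exact h.integrableOn_power)
  rw [uIcc_of_le h.pos.le] at hc
  exact (hc t ht).tendsto.mono_left hl

/-- As `G` is the dissipation of `x` and the integrated power is continuous, `G` can only jump
through the state variable of the corrected energy. Applied from the left and from the right, this
yields the energy balance. -/
lemma tendsto_G (h : ConvergentSolutionSeq T E f ε xn un u M U P K x G) {t : ℝ}
    (ht : t ∈ Icc 0 T) {l : Filter ℝ} (hl : l ≤ 𝓝[Icc 0 T] t) {y : Vec d}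
    (hy : Tendsto x l (𝓝 y)) :
    Tendsto G l (𝓝 (corrEnergy E 0 (x 0) (u 0) - corrEnergy E t y (u t) +
      ∫ τ in (0 : ℝ)..t, power T E f x u τ)) := by
  have hl' : Tendsto (fun s => s) l (𝓝[Icc 0 T] t) := hl
  have hl2 := tendsto_nhdsWithin_iff.1 hl'
  have h1 := h.tendsto_corrEnergy_of_tendsto ht hl2.1 hl2.2 hy
    ((h.control_cont t ht).tendsto.comp hl')
  refine ((tendsto_const_nhds.sub h1).add (h.tendsto_integral_power ht hl)).congr' ?_
  filter_upwards [hl2.2] with s hs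
  rw [h.eq_dissipation hs, dissipation]
  rfl

variable {xm xp : ℝ → Vec d}

lemma leftLim_G (h : ConvergentSolutionSeq T E f ε xn un u M U P K x G)
    (hx : IsOneSidedLimits T x xm xp) {t : ℝ} (ht : t ∈ Icc 0 T) :
    Function.leftLim G t = corrEnergy E 0 (x 0) (u 0) - corrEnergy E t (xm t) (u t) +
      ∫ τ in (0 : ℝ)..t, power T E f x u τ := by
  rcases ht.1.eq_or_lt with rfl | h0
  · rw [hx.left_zero]
    have : Function.leftLim G 0 = G 0 := leftLim_eq_of_tendsto
      (tendsto_const_nhds.congr' (by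
        filter_upwards [self_mem_nhdsWithin] with s hs using (h.G_of_le (le_of_lt hs)).symm))
    rw [this, h.eq_dissipation ht, dissipation]
  · exact leftLim_eq_of_tendsto
      (h.tendsto_G ht (nhdsLT_le ⟨h0, ht.2⟩) (hx.left t ⟨h0, ht.2⟩))

lemma rightLim_G (h : ConvergentSolutionSeq T E f ε xn un u M U P K x G)
    (hx : IsOneSidedLimits T x xm xp) {t : ℝ} (ht : t ∈ Icc 0 T) :
    Function.rightLim G t = corrEnergy E 0 (x 0) (u 0) - corrEnergy E t (xp t) (u t) +
      ∫ τ in (0 : ℝ)..t, power T E f x u τ := by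
  rcases ht.2.eq_or_lt with rfl | h0
  · rw [hx.right_end]
    have : Function.rightLim G t = G t := rightLim_eq_of_tendsto
      (tendsto_const_nhds.congr' (by
        filter_upwards [self_mem_nhdsWithin] with s hs using (h.G_of_ge (le_of_lt hs)).symm))
    rw [this, h.eq_dissipation ht, dissipation]
  · exact rightLim_eq_of_tendsto
      (h.tendsto_G ht (nhdsGT_le ⟨ht.1, h0⟩) (hx.right t ⟨ht.1, h0⟩))

lemma energy_balance (h : ConvergentSolutionSeq T E f ε xn un u M U P K x G)
    (hx : IsOneSidedLimits T x xm xp) {s t : ℝ} (hs : s ∈ Icc 0 T) (ht : t ∈ Icc 0 T)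
    (hst : s ≤ t) :
    corrEnergy E t (xp t) (u t) + (defectMeasure T h.mono).real (Icc s t) =
      corrEnergy E s (xm s) (u s) + ∫ τ in s..t, power T E f x u τ := by
  rw [Measure.real, defectMeasure_Icc h.mono hs ht, ENNReal.toReal_ofReal
    (sub_nonneg.2 (h.mono.leftLim_le_rightLim hst)), h.leftLim_G hx hs, h.rightLim_G hx ht]
  have hI : ∀ r ∈ Icc 0 T, IntervalIntegrable (power T E f x u) volume 0 r := fun r hr =>
    (intervalIntegrable_iff_integrableOn_Icc_of_le hr.1).2
      (h.integrableOn_power.mono_set (Icc_subset_Icc_right hr.2))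
  rw [← intervalIntegral.integral_interval_sub_left (hI t ht) (hI s hs)]
  ring

/-- If `x` is continuous at `t`, both one-sided limits equal `x t` and the formulas for the two
limits of `G` coincide. Conversely, continuity of `G` makes `x` converge along `𝓝[Icc 0 T] t`; this
filter sees `t` itself, so the limit can only be `x t`. -/
lemma continuousWithinAt_iff (h : ConvergentSolutionSeq T E f ε xn un u M U P K x G)
    (hx : IsOneSidedLimits T x xm xp) {t : ℝ} (ht : t ∈ Icc 0 T) :
    ContinuousWithinAt x (Icc 0 T) t ↔ ContinuousAt G t := by
  constructor
  · intro hc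
    have h1 : xm t = x t := by
      rcases ht.1.eq_or_lt with rfl | h0
      · exact hx.left_zero
      · exact tendsto_nhds_unique (hx.left t ⟨h0, ht.2⟩)
          (hc.tendsto.mono_left (nhdsLT_le ⟨h0, ht.2⟩))
    have h2 : xp t = x t := by
      rcases ht.2.eq_or_lt with rfl | h0
      · exact hx.right_end
      · exact tendsto_nhds_unique (hx.right t ⟨ht.1, h0⟩)
          (hc.tendsto.mono_left (nhdsGT_le ⟨ht.1, h0⟩))
    rw [h.mono.continuousAt_iff_leftLim_eq_rightLim, h.leftLim_G hx ht, h.rightLim_G hx ht, h1, h2]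
  · intro hc
    have : (𝓝[Icc 0 T] t).NeBot := mem_closure_iff_nhdsWithin_neBot.1 (subset_closure ht)
    obtain ⟨y, hy⟩ := h.exists_tendsto_of_tendsto_G ht le_rfl
      (hc.tendsto.mono_left nhdsWithin_le_nhds)
    have h1 : Tendsto x (pure t) (𝓝 y) := hy.mono_left (pure_le_nhdsWithin ht)
    have h2 : x t = y := tendsto_nhds_unique (tendsto_pure_nhds x t) h1
    rw [ContinuousWithinAt, h2]
    exact hy

lemma atomSet_eq_discontinuitySet (h : ConvergentSolutionSeq T E f ε xn un u M U P K x G)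
    (hx : IsOneSidedLimits T x xm xp) :
    atomSet T (defectMeasure T h.mono) = discontinuitySet T x := by
  rw [atomSet_eq]
  ext t
  exact and_congr_right fun ht => not_congr (h.continuousWithinAt_iff hx ht).symm

lemma countable_atomSet (hG : Monotone G) : (atomSet T (defectMeasure T hG)).Countable := by
  rw [atomSet_eq]
  exact hG.countable_not_continuousAt.mono fun t ht => ht.2

/-- Convergence in all Lebesgue spaces of finite exponent. -/
lemma tendsto_eLpNorm (h : ConvergentSolutionSeq T E f ε xn un u M U P K x G) {p : ENNReal}
    (hp : 1 ≤ p) (hp' : p ≠ ⊤) :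
    Tendsto (fun n => eLpNorm (fun t => xn n t - x t) p (volume.restrict (Icc 0 T)))
      atTop (𝓝 0) := by
  have hp0 : p ≠ 0 := (one_pos.trans_le hp).ne'
  have hpr : 0 < p.toReal := ENNReal.toReal_pos hp0 hp'
  have hmeas : ∀ n, AEStronglyMeasurable (fun t => xn n t - x t) (volume.restrict (Icc 0 T)) :=
    fun n => ((h.sol n).continuousOn_state.aestronglyMeasurable measurableSet_Icc).sub
      h.aestronglyMeasurable_state
  have key : Tendsto (fun n => ∫⁻ t in Icc 0 T, ‖xn n t - x t‖ₑ ^ p.toReal) atTop (𝓝 0) := by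
    have := tendsto_lintegral_of_dominated_convergence' (μ := volume.restrict (Icc 0 T))
      (F := fun n t => ‖xn n t - x t‖ₑ ^ p.toReal) (f := fun _ => 0)
      (fun _ => ENNReal.ofReal (M + M) ^ p.toReal)
      (fun n => (hmeas n).enorm.pow_const _)
      (fun n => (ae_restrict_iff' measurableSet_Icc).2 (Eventually.of_forall fun t ht => by
        refine ENNReal.rpow_le_rpow ?_ hpr.le
        rw [← ofReal_norm]
        exact ENNReal.ofReal_le_ofReal ((norm_sub_le _ _).trans
          (add_le_add (h.state_le n t ht) (h.norm_state_le ht)))))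
      (by
        rw [lintegral_const]
        exact ENNReal.mul_ne_top (ENNReal.rpow_ne_top_of_nonneg hpr.le ENNReal.ofReal_ne_top)
          (by simp))
      ((ae_restrict_iff' measurableSet_Icc).2 (Eventually.of_forall fun t ht => by
        have h1 : Tendsto (fun n => ‖xn n t - x t‖ₑ) atTop (𝓝 0) := by
          have := ((h.tendsto_state t ht).sub_const (x t)).enorm
          simpa using this
        have h2 := (ENNReal.continuous_rpow_const (y := p.toReal)).tendsto 0 |>.comp h1
        simpa [ENNReal.zero_rpow_of_pos hpr, Function.comp_def] using h2))
    simpa using this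
  simp only [eLpNorm_eq_lintegral_rpow_enorm_toReal hp0 hp']
  have := (ENNReal.continuous_rpow_const (y := 1 / p.toReal)).tendsto 0 |>.comp key
  simpa [ENNReal.zero_rpow_of_pos (inv_pos.2 hpr), Function.comp_def] using this

lemma memLp_top_state (h : ConvergentSolutionSeq T E f ε xn un u M U P K x G) :
    MemLp x ⊤ (volume.restrict (Icc 0 T)) :=
  memLp_top_of_bound h.aestronglyMeasurable_state M
    ((ae_restrict_iff' measurableSet_Icc).2 (Eventually.of_forall fun _ ht => h.norm_state_le ht))

end ConvergentSolutionSeq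

section Transitions

variable {t : ℝ} {u : Vec d}

/-! ### Admissible transitions: lower bound for the cost -/

/-- The integrand of the transition cost. -/
noncomputable def costDensity (E : ℝ → Vec d → ℝ) (t : ℝ) (u : Vec d) (θ : ℝ → Vec d) (s : ℝ) :
    ENNReal :=
  ENNReal.ofReal (‖gradX E t (θ s) - u‖ * ‖deriv θ s‖)

lemma IsEnergy.contDiff_corrEnergy (hE : IsEnergy T E) (ht : t ∈ Icc 0 T) (u : Vec d) :
    ContDiff ℝ 1 (fun x => corrEnergy E t x u) := by
  refine ContDiff.sub ?_ (contDiff_const.inner ℝ contDiff_id)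
  rw [← contDiffOn_univ]
  have hm : MapsTo (fun x : Vec d => (t, x)) univ (Icc 0 T ×ˢ univ) :=
    fun x _ => ⟨ht, mem_univ x⟩
  exact hE.contDiffOn.comp (contDiff_prodMk_right t).contDiffOn hm

lemma IsEnergy.hasFDerivAt_corrEnergy (hE : IsEnergy T E) (ht : t ∈ Icc 0 T) (u x : Vec d) :
    HasFDerivAt (fun x => corrEnergy E t x u)
      (innerSL ℝ (gradX E t x - u)) x := by
  have h1 := (hE.hasGradientAt ht x).hasFDerivAt
  have h2 : HasFDerivAt (fun x : Vec d => inner ℝ u x) (innerSL ℝ u) x :=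
    (innerSL ℝ u).hasFDerivAt
  refine (h1.sub h2).congr_fderiv ?_
  rw [map_sub]
  rfl

/-- On an interval where the curve is Lipschitz, the cost dominates the energy drop. -/
lemma IsEnergy.energy_drop_le_of_lipschitzOn (hE : IsEnergy T E) (ht : t ∈ Icc 0 T)
    {θ : ℝ → Vec d} {a b : ℝ} (hab : a ≤ b) {L : NNReal} (hθ : LipschitzOnWith L θ (Icc a b)) :
    ENNReal.ofReal (corrEnergy E t (θ a) u - corrEnergy E t (θ b) u) ≤
      ∫⁻ s in Icc a b, costDensity E t u θ s := by
  set h : ℝ → ℝ := fun s => corrEnergy E t (θ s) u with hh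
  obtain ⟨L', hL'⟩ := LocallyLipschitzOn.exists_lipschitzOnWith_of_compact
    (isCompact_Icc.image_of_continuousOn hθ.continuousOn)
    ((hE.contDiff_corrEnergy ht u).locallyLipschitz.locallyLipschitzOn (s := θ '' Icc a b))
  -- The energy along the curve is Lipschitz, hence absolutely continuous and the integral of its
  -- derivative; the chain rule holds at almost every time.
  have hlip : LipschitzOnWith (L' * L) h (uIcc a b) := by
    rw [uIcc_of_le hab]
    exact hL'.comp hθ (mapsTo_image _ _)
  have hint := hlip.absolutelyContinuousOnInterval.integral_deriv_eq_sub
  have h1 : ENNReal.ofReal (h a - h b) ≤ ‖∫ s in a..b, deriv h s‖ₑ := by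
    rw [hint, ← ofReal_norm, norm_sub_rev]
    exact ENNReal.ofReal_le_ofReal (le_abs_self _)
  refine h1.trans ?_
  rw [intervalIntegral.integral_of_le hab, ← integral_Icc_eq_integral_Ioc]
  refine (enorm_integral_le_lintegral_enorm _).trans
    (lintegral_mono_ae ((ae_restrict_iff' measurableSet_Icc).2 ?_))
  have ha : ∀ᵐ s : ℝ, s ≠ a := by simp [ae_iff]
  have hb : ∀ᵐ s : ℝ, s ≠ b := by simp [ae_iff]
  filter_upwards [hθ.ae_differentiableWithinAt_of_mem_real, ha, hb] with s hs hsa hsb hsI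
  have hd : DifferentiableAt ℝ θ s := (hs hsI).differentiableAt
    (Icc_mem_nhds (lt_of_le_of_ne hsI.1 hsa.symm) (lt_of_le_of_ne hsI.2 hsb))
  have hder := ((hE.hasFDerivAt_corrEnergy ht u (θ s)).comp_hasDerivAt s hd.hasDerivAt).deriv
  have hder' : deriv h s = inner ℝ (gradX E t (θ s) - u) (deriv θ s) := hder
  rw [hder', costDensity, ← ofReal_norm]
  exact ENNReal.ofReal_le_ofReal (norm_inner_le_norm _ _)

/-- The Lipschitz constant may blow up at the endpoints. The estimate holds on compact subintervals
with the full cost as upper bound, and continuity of the curve carries the energies to the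
endpoints. -/
lemma IsEnergy.energy_drop_le_of_locallyLipschitzOn (hE : IsEnergy T E) (ht : t ∈ Icc 0 T)
    {θ : ℝ → Vec d} {a b : ℝ} (hab : a < b) (hc : ContinuousOn θ (Icc a b))
    (hθ : LocallyLipschitzOn (Ioo a b) θ) :
    ENNReal.ofReal (corrEnergy E t (θ a) u - corrEnergy E t (θ b) u) ≤
      ∫⁻ s in Icc a b, costDensity E t u θ s := by
  have hcont : ContinuousOn (fun s => corrEnergy E t (θ s) u) (Icc a b) :=
    (hE.contDiff_corrEnergy ht u).continuous.comp_continuousOn hc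
  have key : ∀ p q, a < p → p ≤ q → q < b →
      ENNReal.ofReal (corrEnergy E t (θ p) u - corrEnergy E t (θ q) u) ≤
        ∫⁻ s in Icc a b, costDensity E t u θ s := by
    intro p q hp hpq hq
    obtain ⟨L, hL⟩ := (hθ.mono (Icc_subset_Ioo hp hq)).exists_lipschitzOnWith_of_compact
      isCompact_Icc
    exact (hE.energy_drop_le_of_lipschitzOn ht hpq hL).trans
      (lintegral_mono_set (Icc_subset_Icc hp.le hq.le))
  have hleft : Tendsto (fun p => corrEnergy E t (θ p) u) (𝓝[>] a)
      (𝓝 (corrEnergy E t (θ a) u)) :=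
    (hcont a ⟨le_rfl, hab.le⟩).tendsto.mono_left
      (nhdsWithin_le_of_mem (mem_of_superset (Ioo_mem_nhdsGT hab) Ioo_subset_Icc_self))
  have hright : Tendsto (fun p => corrEnergy E t (θ p) u) (𝓝[<] b)
      (𝓝 (corrEnergy E t (θ b) u)) :=
    (hcont b ⟨hab.le, le_rfl⟩).tendsto.mono_left
      (nhdsWithin_le_of_mem (mem_of_superset (Ioo_mem_nhdsLT hab) Ioo_subset_Icc_self))
  have key2 : ∀ q, a < q → q < b →
      ENNReal.ofReal (corrEnergy E t (θ a) u - corrEnergy E t (θ q) u) ≤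
        ∫⁻ s in Icc a b, costDensity E t u θ s := fun q haq hq =>
    le_of_tendsto (ENNReal.tendsto_ofReal (hleft.sub_const _))
      (by filter_upwards [Ioo_mem_nhdsGT haq] with p hp using key p q hp.1 hp.2.le hq)
  exact le_of_tendsto (ENNReal.tendsto_ofReal (hright.const_sub _))
      (by filter_upwards [Ioo_mem_nhdsLT hab] with q hq using key2 q hq.1 hq.2)

/-- The cost of an admissible transition dominates the energy drop. -/
theorem IsTransition.energy_drop_le (hE : IsEnergy T E) (ht : t ∈ Icc 0 T) {x₁ x₂ : Vec d}
    {θ : ℝ → Vec d} (hθ : IsTransition E t x₁ x₂ u θ) :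
    ENNReal.ofReal (corrEnergy E t x₁ u - corrEnergy E t x₂ u) ≤
      ∫⁻ s in Icc 0 1, costDensity E t u θ s := by
  obtain ⟨m, τ, h0, hm, hlt, hlip, -, -⟩ := hθ.partition
  have hmono : ∀ i ≤ m, ∀ j ≤ i, τ j ≤ τ i := by
    intro i hi
    induction i with
    | zero => intro j hj; rw [Nat.le_zero.1 hj]
    | succ i ih =>
      intro j hj
      rcases Nat.le_succ_iff.1 hj with hj | rfl
      · exact (ih (by omega) j hj).trans (hlt i (by omega)).le
      · exact le_rfl
  -- Half-open intervals make the pieces disjoint, so their costs add exactly.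
  have key : ∀ k ≤ m, ENNReal.ofReal (corrEnergy E t (θ 0) u - corrEnergy E t (θ (τ k)) u) ≤
      ∫⁻ s in Ico 0 (τ k), costDensity E t u θ s := by
    intro k hk
    induction k with
    | zero => simp [h0]
    | succ k ih =>
      have hk0 : 0 ≤ τ k := h0 ▸ hmono k (by omega) 0 (by omega)
      have hk1 : τ (k + 1) ≤ 1 := hm ▸ hmono m le_rfl (k + 1) hk
      have hkk := hlt k (by omega)
      have h1 := hE.energy_drop_le_of_locallyLipschitzOn ht (u := u) hkk
        (hθ.continuousOn.mono (Icc_subset_Icc hk0 hk1)) (hlip k (by omega))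
      rw [setLIntegral_congr Ico_ae_eq_Icc.symm] at h1
      rw [← Ico_union_Ico_eq_Ico hk0 hkk.le, lintegral_union measurableSet_Ico
        (Ico_disjoint_Ico_same)]
      refine le_trans ?_ (add_le_add (ih (by omega)) h1)
      rw [← sub_add_sub_cancel _ (corrEnergy E t (θ (τ k)) u)]
      exact ENNReal.ofReal_add_le
  have := key m le_rfl
  rw [hm, hθ.source, hθ.target] at this
  exact this.trans (lintegral_mono_set Ico_subset_Icc_self)

/-! ### Lipschitz arcs -/

/-- A Lipschitz arc on `[a,b]` which meets the critical set finitely often and has cost at most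
`κ`. -/
structure IsArc (E : ℝ → Vec d → ℝ) (t : ℝ) (u : Vec d) (a b : ℝ) (θ : ℝ → Vec d) (κ : ℝ) :
    Prop where
  lipschitz : ∃ L, LipschitzOnWith L θ (Icc a b)
  finite : {s | s ∈ Icc a b ∧ θ s ∈ critSet E t u}.Finite
  cost : ∫⁻ s in Ioo a b, costDensity E t u θ s ≤ ENNReal.ofReal κ

namespace IsArc

variable {a b c κ κ' : ℝ} {θ θ' : ℝ → Vec d}

lemma mono (h : IsArc E t u a b θ κ) (hκ : κ ≤ κ') : IsArc E t u a b θ κ' :=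
  ⟨h.lipschitz, h.finite, h.cost.trans (ENNReal.ofReal_le_ofReal hκ)⟩

/-- The cost is invariant under reparametrisation: the factor `c` from the derivative is the
Jacobian of the substitution. -/
lemma comp_affine {e a' b' : ℝ} (hc : 0 < c) (ha : c * a' + e = a) (hb : c * b' + e = b)
    (h : IsArc E t u a b θ κ) : IsArc E t u a' b' (fun s => θ (c * s + e)) κ := by
  have hmaps : MapsTo (fun s => c * s + e) (Icc a' b') (Icc a b) := by
    intro s hs
    rw [← ha, ← hb]
    exact ⟨by have := mul_le_mul_of_nonneg_left hs.1 hc.le; linarith,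
      by have := mul_le_mul_of_nonneg_left hs.2 hc.le; linarith⟩
  have hinj : Function.Injective (fun s => c * s + e) := fun s s' hss => by
    have : c * s = c * s' := by simpa using hss
    exact mul_left_cancel₀ hc.ne' this
  refine ⟨?_, ?_, ?_⟩
  · obtain ⟨L, hL⟩ := h.lipschitz
    refine ⟨L * ⟨c, hc.le⟩, hL.comp (LipschitzWith.lipschitzOnWith ?_) hmaps⟩
    refine LipschitzWith.of_dist_le_mul fun s s' => ?_
    rw [Real.dist_eq, Real.dist_eq, add_sub_add_right_eq_sub, ← mul_sub, abs_mul, abs_of_pos hc]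
    rfl
  · refine (h.finite.preimage (f := fun s => c * s + e) hinj.injOn).subset ?_
    exact fun s hs => ⟨hmaps hs.1, hs.2⟩
  · refine le_trans (le_of_eq ?_) h.cost
    have himg : (fun s => c * s + e) '' Ioo a' b' = Ioo a b := by
      rw [← ha, ← hb]
      exact Set.image_affine_Ioo hc _ _ _
    rw [← himg, lintegral_image_eq_lintegral_abs_deriv_mul measurableSet_Ioo (f' := fun _ => c)
      (fun s _ => by
        simpa using (((hasDerivAt_id s).const_mul c).add_const e).hasDerivWithinAt) hinj.injOn]
    refine lintegral_congr fun s => ?_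
    have hder : deriv (fun s => θ (c * s + e)) s = c • deriv θ (c * s + e) := by
      rw [deriv_comp_mul_left c (fun r => θ (r + e)) s, deriv_comp_add_const]
    rw [costDensity, costDensity, hder, norm_smul, Real.norm_eq_abs, ← ENNReal.ofReal_mul
      (abs_nonneg c)]
    congr 1
    ring

/-- Across the junction the Lipschitz bound follows from `dist s s' = dist s b + dist b s'`. The
derivative may fail to exist at `b`, but a single point does not affect the cost. -/
lemma concat (hab : a ≤ b) (hbc : b ≤ c) (hθ : IsArc E t u a b θ κ) (hθ' : IsArc E t u b c θ' κ')
    (heq : θ b = θ' b) (hκ : 0 ≤ κ) (hκ' : 0 ≤ κ') :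
    IsArc E t u a c (fun s => if s ≤ b then θ s else θ' s) (κ + κ') := by
  obtain ⟨L, hL⟩ := hθ.lipschitz
  obtain ⟨L', hL'⟩ := hθ'.lipschitz
  refine ⟨⟨max L L', LipschitzOnWith.of_dist_le_mul ?_⟩, ?_, ?_⟩
  · have hL1 : LipschitzOnWith (max L L') θ (Icc a b) := hL.weaken (le_max_left _ _)
    have hL2 : LipschitzOnWith (max L L') θ' (Icc b c) := hL'.weaken (le_max_right _ _)
    have hmix : ∀ s s' : ℝ, s ∈ Icc a b → s' ∈ Icc b c →
        dist (θ s) (θ' s') ≤ (max L L' : NNReal) * dist s s' := by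
      intro s s' hs hs'
      have h1 := hL1.dist_le_mul s hs b ⟨hab, le_rfl⟩
      have h2 := hL2.dist_le_mul b ⟨le_rfl, hbc⟩ s' hs'
      have h3 := dist_triangle (θ s) (θ b) (θ' s')
      rw [heq] at h1 h3
      have h4 : dist s s' = dist s b + dist b s' := by
        rw [Real.dist_eq, Real.dist_eq, Real.dist_eq, abs_sub_comm, abs_sub_comm s b,
          abs_sub_comm b s', abs_of_nonneg (by linarith [hs.2, hs'.1]),
          abs_of_nonneg (by linarith [hs.2]), abs_of_nonneg (by linarith [hs'.1])]
        ring
      rw [h4, mul_add]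
      linarith
    intro s hs s' hs'
    by_cases h1 : s ≤ b <;> by_cases h2 : s' ≤ b <;> simp only [h1, h2, if_true, if_false]
    · exact hL1.dist_le_mul s ⟨hs.1, h1⟩ s' ⟨hs'.1, h2⟩
    · exact hmix s s' ⟨hs.1, h1⟩ ⟨(not_le.1 h2).le, hs'.2⟩
    · rw [dist_comm, dist_comm s s']
      exact hmix s' s ⟨hs'.1, h2⟩ ⟨(not_le.1 h1).le, hs.2⟩
    · exact hL2.dist_le_mul s ⟨(not_le.1 h1).le, hs.2⟩ s' ⟨(not_le.1 h2).le, hs'.2⟩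
  · refine (hθ.finite.union hθ'.finite).subset ?_
    rintro s ⟨hs, hsc⟩
    by_cases h1 : s ≤ b
    · simp only [h1, if_true] at hsc
      exact Or.inl ⟨⟨hs.1, h1⟩, hsc⟩
    · simp only [h1, if_false] at hsc
      exact Or.inr ⟨⟨(not_le.1 h1).le, hs.2⟩, hsc⟩
  · have hsub : Ioo a c ⊆ (Ioo a b ∪ Ioo b c) ∪ {b} := by
      intro s hs
      rcases lt_trichotomy s b with h | h | h
      · exact Or.inl (Or.inl ⟨hs.1, h⟩)
      · exact Or.inr h
      · exact Or.inl (Or.inr ⟨h, hs.2⟩)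
    refine (lintegral_mono_set hsub).trans ((lintegral_union_le _ _ _).trans ?_)
    rw [setLIntegral_measure_zero {b} _ (by simp), add_zero]
    refine (lintegral_union_le _ _ _).trans ?_
    rw [ENNReal.ofReal_add hκ hκ']
    refine add_le_add (le_trans (le_of_eq ?_) hθ.cost) (le_trans (le_of_eq ?_) hθ'.cost)
    · refine setLIntegral_congr_fun measurableSet_Ioo fun s hs => ?_
      have he : (fun s => if s ≤ b then θ s else θ' s) =ᶠ[𝓝 s] θ := by
        filter_upwards [Iio_mem_nhds hs.2] with r hr
        rw [if_pos (le_of_lt hr)]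
      simp only [costDensity, he.deriv_eq, he.eq_of_nhds]
    · refine setLIntegral_congr_fun measurableSet_Ioo fun s hs => ?_
      have he : (fun s => if s ≤ b then θ s else θ' s) =ᶠ[𝓝 s] θ' := by
        filter_upwards [Ioi_mem_nhds hs.1] with r hr
        rw [if_neg (not_le.2 hr)]
      simp only [costDensity, he.deriv_eq, he.eq_of_nhds]

end IsArc

/-- Two points are joined at cost `κ` if they coincide or are the endpoints of an arc of cost at
most `κ`. -/
def Joined (E : ℝ → Vec d → ℝ) (t : ℝ) (u x y : Vec d) (κ : ℝ) : Prop :=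
  0 ≤ κ ∧ (x = y ∨ ∃ θ, θ 0 = x ∧ θ 1 = y ∧ IsArc E t u 0 1 θ κ)

namespace Joined

variable {x y z : Vec d} {κ κ' : ℝ}

lemma of_isArc {a b : ℝ} {θ : ℝ → Vec d} (hab : a < b) (hκ : 0 ≤ κ) (h : IsArc E t u a b θ κ) :
    Joined E t u (θ a) (θ b) κ :=
  ⟨hκ, Or.inr ⟨fun s => θ ((b - a) * s + a), by simp, by simp,
    h.comp_affine (sub_pos.2 hab) (by ring) (by ring)⟩⟩

lemma mono (h : Joined E t u x y κ) (hκ : κ ≤ κ') : Joined E t u x y κ' :=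
  ⟨h.1.trans hκ, h.2.imp_right fun ⟨θ, h0, h1, h2⟩ => ⟨θ, h0, h1, h2.mono hκ⟩⟩

/-- The alternative `x = y` in `Joined` is needed here: a constant curve at a critical point meets
the critical set at every time and is not an arc. -/
lemma refl (x : Vec d) : Joined E t u x x 0 := ⟨le_rfl, Or.inl rfl⟩

lemma trans (h : Joined E t u x y κ) (h' : Joined E t u y z κ') :
    Joined E t u x z (κ + κ') := by
  obtain ⟨hκ, rfl | ⟨θ, h0, h1, hθ⟩⟩ := h
  · exact h'.mono (by linarith)
  obtain ⟨hκ', rfl | ⟨θ', h0', h1', hθ'⟩⟩ := h'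
  · exact Joined.mono ⟨hκ, Or.inr ⟨θ, h0, h1, hθ⟩⟩ (by linarith)
  -- The second arc is moved to `[1,2]`; `of_isArc` rescales the concatenation on `[0,2]` back to
  -- `[0,1]`.
  have hshift := hθ'.comp_affine (a' := 1) (b' := 2) (c := 1) (e := -1) one_pos (by norm_num)
    (by norm_num)
  have := of_isArc (by norm_num) (add_nonneg hκ hκ') (hθ.concat (by norm_num) (by norm_num) hshift
    (by simp [h1, h0']) hκ hκ')
  norm_num [h0, h1'] at this
  exact this

end Joined

/-! ### Admissible transitions: construction -/

/-- The partition consists of the finitely many critical times together with `0` and `1`, listed in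
increasing order. -/
lemma IsArc.isTransition {θ : ℝ → Vec d} {κ : ℝ} (h : IsArc E t u 0 1 θ κ) :
    IsTransition E t (θ 0) (θ 1) u θ := by
  obtain ⟨L, hL⟩ := h.lipschitz
  refine ⟨hL.continuousOn, rfl, rfl, ?_⟩
  set S : Finset ℝ := h.finite.toFinset ∪ {0, 1} with hS
  have h0 : (0 : ℝ) ∈ S := by simp [hS]
  have h1 : (1 : ℝ) ∈ S := by simp [hS]
  have hSI : ∀ s ∈ S, s ∈ Icc (0 : ℝ) 1 := by
    intro s hs
    simp only [hS, Finset.mem_union, Finite.mem_toFinset, Finset.mem_insert,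
      Finset.mem_singleton] at hs
    rcases hs with hs | rfl | rfl
    exacts [hs.1, ⟨le_rfl, zero_le_one⟩, ⟨zero_le_one, le_rfl⟩]
  have hcard : 0 < S.card := Finset.card_pos.2 ⟨0, h0⟩
  set e := S.orderEmbOfFin rfl with he
  -- The last node has index `S.card - 1`; the value `0` beyond it is never used.
  set τ : ℕ → ℝ := fun i => if hi : i < S.card then e ⟨i, hi⟩ else 0 with hτ
  have hτi : ∀ i (hi : i < S.card), τ i = e ⟨i, hi⟩ := fun i hi => dif_pos hi
  have hτS : ∀ i < S.card, τ i ∈ S := fun i hi => by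
    rw [hτi i hi]; exact S.orderEmbOfFin_mem rfl _
  have hlt : ∀ i j, i < j → j < S.card → τ i < τ j := fun i j hij hj => by
    rw [hτi i (hij.trans hj), hτi j hj]
    exact e.strictMono hij
  have hτ0 : τ 0 = 0 := by
    rw [hτi 0 hcard, he, Finset.orderEmbOfFin_zero rfl hcard]
    exact le_antisymm (S.min'_le 0 h0) (S.le_min' _ _ fun s hs => (hSI s hs).1)
  have hτ1 : τ (S.card - 1) = 1 := by
    rw [hτi _ (Nat.sub_lt hcard one_pos), he, Finset.orderEmbOfFin_last rfl hcard]
    exact le_antisymm (S.max'_le _ _ fun s hs => (hSI s hs).2) (S.le_max' 1 h1)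
  refine ⟨S.card - 1, τ, hτ0, hτ1, fun i hi => hlt i (i + 1) (by omega) (by omega),
    fun i hi => ?_, fun i hi hi' => ?_, fun s hs hne hcrit => ?_⟩
  · have hsub : Ioo (τ i) (τ (i + 1)) ⊆ Icc 0 1 := fun s hs =>
      ⟨(hSI _ (hτS i (by omega))).1.trans hs.1.le, hs.2.le.trans (hSI _ (hτS _ (by omega))).2⟩
    exact fun s _ => ⟨L, _, self_mem_nhdsWithin, hL.mono hsub⟩
  · have hmem := hτS i (by omega)
    have hp : 0 < τ i := hτ0 ▸ hlt 0 i hi (by omega)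
    have hq : τ i < 1 := hτ1 ▸ hlt i _ hi' (by omega)
    simp only [hS, Finset.mem_union, Finite.mem_toFinset, Finset.mem_insert,
      Finset.mem_singleton] at hmem
    rcases hmem with hmem | hmem | hmem
    exacts [hmem.2, absurd hmem hp.ne', absurd hmem hq.ne]
  · have hmem : s ∈ S := by
      simp only [hS, Finset.mem_union, Finite.mem_toFinset]
      exact Or.inl ⟨hs, hcrit⟩
    have hr : s ∈ range e := by rw [he, Finset.range_orderEmbOfFin]; exact hmem
    obtain ⟨i, hi⟩ := hr
    refine hne i (by omega) ?_
    rw [hτi i i.2]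
    exact hi.symm

lemma Joined.transitionCost_le {x y : Vec d} {κ : ℝ} (h : Joined E t u x y κ) :
    transitionCost E t x y u ≤ ENNReal.ofReal κ := by
  rw [transitionCost]
  split_ifs with hxy
  · exact zero_le
  · obtain ⟨-, rfl | ⟨θ, rfl, rfl, hθ⟩⟩ := h
    · exact absurd rfl hxy
    · refine (iInf₂_le θ hθ.isTransition).trans ?_
      rw [setLIntegral_congr Ioo_ae_eq_Icc.symm]
      exact hθ.cost

/-- Segments with at most one critical point. -/
lemma Joined.segment {y z q : Vec d} {β : ℝ}
    (hseg : ∀ w ∈ segment ℝ y z, w ≠ q → w ∉ critSet E t u)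
    (hβ : ∀ w ∈ segment ℝ y z, ‖gradX E t w - u‖ ≤ β) :
    Joined E t u y z (β * ‖z - y‖) := by
  have hβ0 : 0 ≤ β := (norm_nonneg _).trans (hβ y (left_mem_segment ℝ y z))
  refine ⟨by positivity, ?_⟩
  by_cases hyz : y = z
  · exact Or.inl hyz
  right
  set θ : ℝ → Vec d := fun s => y + s • (z - y) with hθ
  have hd : ∀ s, HasDerivAt θ (z - y) s := fun s =>
    (((hasDerivAt_id s).smul_const (z - y)).const_add y).congr_deriv (one_smul ℝ _)
  have hmem : ∀ s ∈ Icc (0 : ℝ) 1, θ s ∈ _root_.segment ℝ y z := fun s hs => by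
    rw [segment_eq_image']
    exact ⟨s, hs, rfl⟩
  refine ⟨θ, by simp [hθ], by simp [hθ], ?_, ?_, ?_⟩
  · refine ⟨‖z - y‖₊, (convex_Icc (0 : ℝ) 1).lipschitzOnWith_of_nnnorm_hasDerivWithin_le
      (fun s _ => (hd s).hasDerivWithinAt) (fun s _ => le_rfl)⟩
  · refine Set.Subsingleton.finite ?_
    rintro s ⟨hs, hsc⟩ s' ⟨hs', hsc'⟩
    have e1 : θ s = q := by
      by_contra hne
      exact hseg _ (hmem s hs) hne hsc
    have e2 : θ s' = q := by
      by_contra hne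
      exact hseg _ (hmem s' hs') hne hsc'
    have e3 : s • (z - y) = s' • (z - y) := add_left_cancel (e1.trans e2.symm)
    exact smul_left_injective ℝ (sub_ne_zero.2 (Ne.symm hyz)) e3
  · refine (setLIntegral_mono' (g := fun _ => ENNReal.ofReal (β * ‖z - y‖)) measurableSet_Ioo
      fun s hs => ?_).trans ?_
    · rw [costDensity, (hd s).deriv]
      exact ENNReal.ofReal_le_ofReal (mul_le_mul_of_nonneg_right
        (hβ _ (hmem s (Ioo_subset_Icc_self hs))) (norm_nonneg _))
    · simp

/-- A piece of a solution which avoids the critical set and whose force dominates the frozen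
force is an arc with cost controlled by the dissipation. -/
lemma IsSolution.joined {ε : ℝ} {x₀ u₀ : Vec d} {x v : ℝ → Vec d} (hT : 0 < T) (hE : IsEnergy T E)
    (hf : IsControlField f) (hε : 0 < ε) (h : IsSolution T E f ε x₀ u₀ x v) {p q η : ℝ}
    (hη : 0 ≤ η) (hp : p ∈ Icc 0 T) (hq : q ∈ Icc 0 T) (hpq : p ≤ q)
    (hcrit : ∀ s ∈ Ioo p q, x s ∉ critSet E t u)
    (hforce : ∀ s ∈ Ioo p q,
      ‖gradX E t (x s) - u‖ ≤ (1 + η) * ‖gradX E s (x s) - v s‖) :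
    Joined E t u (x p) (x q)
      ((1 + η) * (dissipation T E f x v q - dissipation T E f x v p)) := by
  have hsub : Icc p q ⊆ Icc 0 T := Icc_subset_Icc hp.1 hq.2
  rcases hpq.eq_or_lt with rfl | hlt
  · simpa using Joined.refl (E := E) (t := t) (u := u) (x p)
  have hd := fun t ht => h.hasDerivWithinAt_dissipation hT hE hf (t := t) ht
  have hDmono := h.monotoneOn_dissipation hT hE hf hε hp hq hpq
  have hκ : 0 ≤ (1 + η) * (dissipation T E f x v q - dissipation T E f x v p) :=
    mul_nonneg (by linarith) (sub_nonneg.2 hDmono)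
  have hvc : ContinuousOn (fun s => gradX E s (x s) - v s) (Icc p q) :=
    ((hE.continuousOn_gradX hT).comp (continuousOn_id.prodMk (h.continuousOn_state.mono hsub))
      (fun y hy => ⟨hsub hy, mem_univ _⟩)).sub (h.continuousOn_control.mono hsub)
  have hder : ∀ s ∈ Ioo p q, HasDerivAt x (ε⁻¹ • (-gradX E s (x s) + v s)) s := fun s hs =>
    hasDerivAt_of_Icc ⟨hp.1.trans_lt hs.1, hs.2.trans_le hq.2⟩
      (h.state s (hsub (Ioo_subset_Icc_self hs)))
  refine Joined.of_isArc hlt hκ ⟨?_, ?_, ?_⟩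
  · obtain ⟨C, hC⟩ := isCompact_Icc.exists_bound_of_continuousOn hvc
    refine ⟨(ε⁻¹ * C).toNNReal, (convex_Icc p q).lipschitzOnWith_of_nnnorm_hasDerivWithin_le
      (fun s hs => (h.state s (hsub hs)).mono hsub) (fun s hs => ?_)⟩
    rw [← NNReal.coe_le_coe, coe_nnnorm, norm_velocity hε]
    exact (mul_le_mul_of_nonneg_left (hC s hs) (by positivity)).trans (Real.le_coe_toNNReal _)
  · refine (Set.toFinite {p, q}).subset ?_
    rintro s ⟨hs, hsc⟩
    by_contra hne
    simp only [mem_insert_iff, mem_singleton_iff, not_or] at hne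
    exact hcrit s ⟨lt_of_le_of_ne hs.1 (Ne.symm hne.1), lt_of_le_of_ne hs.2 hne.2⟩ hsc
  · have hcont : ContinuousOn (fun s => (1 + η) * (ε⁻¹ * ‖gradX E s (x s) - v s‖ ^ 2))
        (Icc p q) := continuousOn_const.mul (continuousOn_const.mul (hvc.norm.pow 2))
    have hint := intervalIntegral.integral_eq_sub_of_hasDerivAt_of_le hlt.le
      (f := fun s => (1 + η) * dissipation T E f x v s)
      (fun s hs => ((hd s (hsub hs)).continuousWithinAt.mono hsub).const_mul _)
      (fun s hs => (hasDerivAt_of_Icc ⟨hp.1.trans_lt hs.1, hs.2.trans_le hq.2⟩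
        (hd s (hsub (Ioo_subset_Icc_self hs)))).const_mul (1 + η))
      (hcont.intervalIntegrable_of_Icc hlt.le)
    have hintegrable : IntegrableOn (fun s => (1 + η) * (ε⁻¹ * ‖gradX E s (x s) - v s‖ ^ 2))
        (Ioo p q) := hcont.integrableOn_Icc.mono_set Ioo_subset_Icc_self
    rw [mul_sub, ← hint, intervalIntegral.integral_of_le hlt.le, integral_Ioc_eq_integral_Ioo,
      ofReal_integral_eq_lintegral_ofReal hintegrable
        (Eventually.of_forall fun s => by positivity)]
    -- Pointwise, frozen force times speed is at most `(1 + η) |force| · ε⁻¹ |force|`, which is `1 +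
    -- η` times the dissipation rate.
    refine setLIntegral_mono' measurableSet_Ioo fun s hs => ENNReal.ofReal_le_ofReal ?_
    rw [(hder s hs).deriv, norm_velocity hε]
    calc ‖gradX E t (x s) - u‖ * (ε⁻¹ * ‖gradX E s (x s) - v s‖)
        ≤ ((1 + η) * ‖gradX E s (x s) - v s‖) * (ε⁻¹ * ‖gradX E s (x s) - v s‖) :=
          mul_le_mul_of_nonneg_right (hforce s hs) (by positivity)
      _ = _ := by ring

/-- Surgery: if pieces of a curve outside finitely many balls are arcs, and points of the balls can
be joined cheaply to the centers, then the endpoints of the curve are joined. -/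
lemma Joined.of_balls {γ : ℝ → Vec d} {A : ℝ → ℝ} {a b r β : ℝ} (hγ : ContinuousOn γ (Icc a b))
    (hA : MonotoneOn A (Icc a b)) (hβ : 0 ≤ β) (Z : Finset (Vec d))
    (hin : ∀ z ∈ Z, ∀ w ∈ Metric.closedBall z r, Joined E t u w z β ∧ Joined E t u z w β)
    (hout : ∀ p ∈ Icc a b, ∀ q ∈ Icc a b, p ≤ q →
      (∀ s ∈ Ioo p q, ∀ z ∈ Z, γ s ∉ Metric.closedBall z r) →
      Joined E t u (γ p) (γ q) (A q - A p)) (hab : a ≤ b) :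
    Joined E t u (γ a) (γ b) (A b - A a + (2 ^ (Z.card + 1) - 2) * β) := by
  classical
  -- Induction on the set `Z'` of balls the piece may still meet. Removing one ball leaves two
  -- pieces and adds two segments, so the number of segments satisfies `N (k + 1) = 2 N k + 2`,
  -- solved by `2 ^ (k + 1) - 2`.
  suffices H : ∀ Z' : Finset (Vec d), Z' ⊆ Z → ∀ p ∈ Icc a b, ∀ q ∈ Icc a b, p ≤ q →
      (∀ s ∈ Ioo p q, ∀ z ∈ Z \ Z', γ s ∉ Metric.closedBall z r) →
      Joined E t u (γ p) (γ q) (A q - A p + (2 ^ (Z'.card + 1) - 2) * β) from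
    H Z (Finset.Subset.refl _) a ⟨le_rfl, hab⟩ b ⟨hab, le_rfl⟩ hab (fun s _ z hz => by simp at hz)
  intro Z'
  induction Z' using Finset.induction_on with
  | empty =>
    intro _ p hp q hq hpq hav
    refine (hout p hp q hq hpq fun s hs z hz => hav s hs z (by simpa using hz)).mono ?_
    simp
  | insert z₀ Z' hz₀ ih =>
    intro hsub p hp q hq hpq hav
    have hsub' : Z' ⊆ Z := (Finset.subset_insert _ _).trans hsub
    have hz₀Z : z₀ ∈ Z := hsub (Finset.mem_insert_self _ _)
    have hpow : (1 : ℝ) ≤ 2 ^ Z'.card := one_le_pow₀ (by norm_num)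
    have hav' : ∀ p' ∈ Icc a b, ∀ q' ∈ Icc a b, p ≤ p' → q' ≤ q →
        (∀ s ∈ Ioo p' q', γ s ∉ Metric.closedBall z₀ r) →
        ∀ s ∈ Ioo p' q', ∀ z ∈ Z \ Z', γ s ∉ Metric.closedBall z r := by
      intro p' _ q' _ h1 h2 h3 s hs z hz
      by_cases hzz : z = z₀
      · rw [hzz]; exact h3 s hs
      · refine hav s ⟨h1.trans_lt hs.1, hs.2.trans_le h2⟩ z ?_
        simp only [Finset.mem_sdiff, Finset.mem_insert, not_or] at hz ⊢
        exact ⟨hz.1, hzz, hz.2⟩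
    rw [Finset.card_insert_of_notMem hz₀]
    set H := Icc p q ∩ γ ⁻¹' Metric.closedBall z₀ r with hH
    have hHc : IsCompact H := isCompact_Icc.of_isClosed_subset
      ((hγ.mono (Icc_subset_Icc hp.1 hq.2)).preimage_isClosed_of_isClosed isClosed_Icc
        Metric.isClosed_closedBall) inter_subset_left
    rcases H.eq_empty_or_nonempty with hemp | hne
    · refine (ih hsub' p hp q hq hpq (hav' p hp q hq le_rfl le_rfl fun s hs hmem => ?_)).mono ?_
      · have : s ∈ H := ⟨Ioo_subset_Icc_self hs, hmem⟩
        rw [hemp] at this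
        exact this
      · have : (2 : ℝ) ^ (Z'.card + 1 + 1) = 2 * 2 ^ (Z'.card + 1) := by ring
        have h2 : (2 : ℝ) ^ (Z'.card + 1) = 2 * 2 ^ Z'.card := by ring
        nlinarith
    -- Everything between the first and last visits to the ball is replaced by two joins through its
    -- center; monotonicity of `A` allows the discarded part to be dropped from the bound.
    · obtain ⟨s₁, ⟨hs₁, hs₁'⟩, hmin⟩ := hHc.exists_isLeast hne
      obtain ⟨s₂, ⟨hs₂, hs₂'⟩, hmax⟩ := hHc.exists_isGreatest hne
      have hs₁I : s₁ ∈ Icc a b := ⟨hp.1.trans hs₁.1, hs₁.2.trans hq.2⟩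
      have hs₂I : s₂ ∈ Icc a b := ⟨hp.1.trans hs₂.1, hs₂.2.trans hq.2⟩
      have hs12 : s₁ ≤ s₂ := hmin ⟨hs₂, hs₂'⟩
      have j1 := ih hsub' p hp s₁ hs₁I hs₁.1 (hav' p hp s₁ hs₁I le_rfl hs₁.2 fun s hs hmem =>
        absurd (hmin ⟨⟨hs.1.le, hs.2.le.trans hs₁.2⟩, hmem⟩) (not_le.2 hs.2))
      have j2 := ih hsub' s₂ hs₂I q hq hs₂.2 (hav' s₂ hs₂I q hq hs₂.1 le_rfl fun s hs hmem =>
        absurd (hmax ⟨⟨hs₂.1.trans hs.1.le, hs.2.le⟩, hmem⟩) (not_le.2 hs.1))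
      refine (((j1.trans (hin z₀ hz₀Z _ hs₁').1).trans (hin z₀ hz₀Z _ hs₂').2).trans j2).mono ?_
      have hA12 := hA hs₁I hs₂I hs12
      have : (2 : ℝ) ^ (Z'.card + 1 + 1) = 2 * 2 ^ (Z'.card + 1) := by ring
      rw [this]
      linarith

lemma IsEnergy.finite_critSet_inter (hT : 0 < T) (hE : IsEnergy T E) (ht : t ∈ Icc 0 T)
    (u : Vec d) {K : Set (Vec d)} (hK : IsCompact K) : (K ∩ critSet E t u).Finite := by
  refine hK.induction_on (p := fun V => (V ∩ critSet E t u).Finite) (by simp)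
    (fun V W hVW hW => hW.subset (inter_subset_inter_left _ hVW))
    (fun V W hV hW => by rw [union_inter_distrib_right]; exact hV.union hW) (fun y _ => ?_)
  obtain ⟨r, hr, h⟩ := hE.exists_punctured_ball hT ht u y
  refine ⟨Metric.ball y r, mem_nhdsWithin_of_mem_nhds (Metric.ball_mem_nhds y hr),
    (finite_singleton y).subset ?_⟩
  rintro z ⟨hz, hzc⟩
  by_contra hne
  exact h z hz hne hzc

/-- Near finitely many points, segments to these points are cheap. -/
lemma IsEnergy.exists_radius (hT : 0 < T) (hE : IsEnergy T E) (ht : t ∈ Icc 0 T) (u : Vec d)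
    (Z : Finset (Vec d)) {β : ℝ} (hβ : 0 < β) :
    ∃ r > 0, ∀ z ∈ Z, ∀ w ∈ Metric.closedBall z r, Joined E t u w z β ∧ Joined E t u z w β := by
  have hgc : Continuous (fun w => ‖gradX E t w - u‖) := by
    rw [← continuousOn_univ]
    exact (((hE.continuousOn_gradX hT).comp (continuousOn_const.prodMk continuousOn_id)
      (fun y _ => ⟨ht, mem_univ _⟩)).sub continuousOn_const).norm
  have hz : ∀ z ∈ Z, ∀ᶠ r in 𝓝[>] (0 : ℝ), ∀ w ∈ Metric.closedBall z r,
      Joined E t u w z β ∧ Joined E t u z w β := by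
    intro z _
    obtain ⟨ρ, hρ, hcrit⟩ := hE.exists_punctured_ball hT ht u z
    obtain ⟨B, hB⟩ := (isCompact_closedBall z ρ).exists_bound_of_continuousOn hgc.continuousOn
    have hB0 : 0 ≤ B := (norm_nonneg _).trans (hB z (Metric.mem_closedBall_self hρ.le))
    -- The first bound keeps the segment in a ball whose only possible critical point is `z`; the
    -- second makes its cost `B ‖w - z‖` at most `β`.
    filter_upwards [Ioo_mem_nhdsGT hρ, Ioo_mem_nhdsGT (show 0 < β / (B + 1) by positivity)]
      with r hr hr' w hw
    have hnw : ‖w - z‖ ≤ r := by simpa [dist_eq_norm] using hw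
    have hcost : B * ‖w - z‖ ≤ β := by
      have h1 := hr'.2
      rw [lt_div_iff₀ (by positivity)] at h1
      nlinarith [norm_nonneg (w - z)]
    have hball : ∀ w' ∈ segment ℝ z w, w' ∈ Metric.ball z ρ := fun w' hw' =>
      Metric.closedBall_subset_ball hr.2 ((convex_closedBall z r).segment_subset
        (Metric.mem_closedBall_self hr.1.le) hw hw')
    have hseg : ∀ w' ∈ segment ℝ z w, w' ≠ z → w' ∉ critSet E t u := fun w' hw' =>
      hcrit w' (hball w' hw')
    have hBseg : ∀ w' ∈ segment ℝ z w, ‖gradX E t w' - u‖ ≤ B := fun w' hw' => by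
      simpa using hB w' (Metric.ball_subset_closedBall (hball w' hw'))
    constructor
    · refine (Joined.segment (q := z) (β := B) ?_ ?_).mono ?_
      · rw [segment_symm]; exact hseg
      · rw [segment_symm]; exact hBseg
      · rwa [norm_sub_rev]
    · exact (Joined.segment hseg hBseg).mono hcost
  obtain ⟨r, h1, h2⟩ := (((Finset.eventually_all Z).2 hz).and self_mem_nhdsWithin).exists
  exact ⟨r, h2, h1⟩

end Transitions

namespace ConvergentSolutionSeq

variable {ε : ℕ → ℝ} {xn un : ℕ → ℝ → Vec d} {u : ℝ → Vec d} {M U P K : ℝ} {x : ℝ → Vec d}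
  {G : ℝ → ℝ} {xm xp : ℝ → Vec d}

/-! ### The cost of jumps -/

/-- One time has to approximate the left limits of `G` and of `x` simultaneously. At `t = 0` there
is nothing to the left, and `0` itself serves because `x₋(0) = x(0)`. -/
lemma exists_left_approx (h : ConvergentSolutionSeq T E f ε xn un u M U P K x G)
    (hx : IsOneSidedLimits T x xm xp) {t : ℝ} (ht : t ∈ Icc 0 T) {δ r ζ : ℝ} (hδ : 0 < δ)
    (hr : 0 < r) (hζ : 0 < ζ) :
    ∃ a ∈ Icc 0 T, a ≤ t ∧ |a - t| < δ ∧ Function.leftLim G t - ζ < G a ∧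
      dist (x a) (xm t) < r := by
  rcases ht.1.eq_or_lt with rfl | h0
  · refine ⟨0, ht, le_rfl, by simpa using hδ, ?_, by simpa [hx.left_zero] using hr⟩
    linarith [h.mono.leftLim_le (le_refl (0 : ℝ))]
  · have e1 := (h.mono.tendsto_leftLim t).eventually_const_lt
      (show Function.leftLim G t - ζ < Function.leftLim G t by linarith)
    have e2 := (hx.left t ⟨h0, ht.2⟩).eventually (Metric.ball_mem_nhds _ hr)
    obtain ⟨a, ⟨⟨h1, h2⟩, h3⟩, h4⟩ := (((e1.and e2).and (Ioo_mem_nhdsLT h0)).and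
      (Ioo_mem_nhdsLT (show t - δ < t by linarith))).exists
    exact ⟨a, ⟨h3.1.le, h3.2.le.trans ht.2⟩, h3.2.le,
      abs_lt.2 ⟨by linarith [h4.1], by linarith [h4.2]⟩, h1, h2⟩

lemma exists_right_approx (h : ConvergentSolutionSeq T E f ε xn un u M U P K x G)
    (hx : IsOneSidedLimits T x xm xp) {t : ℝ} (ht : t ∈ Icc 0 T) {δ r ζ : ℝ} (hδ : 0 < δ)
    (hr : 0 < r) (hζ : 0 < ζ) :
    ∃ b ∈ Icc 0 T, t ≤ b ∧ |b - t| < δ ∧ G b < Function.rightLim G t + ζ ∧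
      dist (x b) (xp t) < r := by
  rcases ht.2.eq_or_lt with rfl | h0
  · refine ⟨t, ht, le_rfl, by simpa using hδ, ?_, by simpa [hx.right_end] using hr⟩
    linarith [h.mono.le_rightLim (le_refl t)]
  · have e1 := (h.mono.tendsto_rightLim t).eventually_lt_const
      (show Function.rightLim G t < Function.rightLim G t + ζ by linarith)
    have e2 := (hx.right t ⟨ht.1, h0⟩).eventually (Metric.ball_mem_nhds _ hr)
    obtain ⟨b, ⟨⟨h1, h2⟩, h3⟩, h4⟩ := (((e1.and e2).and (Ioo_mem_nhdsGT h0)).and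
      (Ioo_mem_nhdsGT (show t < t + δ by linarith))).exists
    exact ⟨b, ⟨ht.1.trans h3.1.le, h3.2.le⟩, h3.1.le,
      abs_lt.2 ⟨by linarith [h4.1], by linarith [h4.2]⟩, h1, h2⟩

/-- The one-sided limits at `t` are joined at a cost arbitrarily close to the jump of the
dissipation. -/
lemma exists_joined (h : ConvergentSolutionSeq T E f ε xn un u M U P K x G)
    (hx : IsOneSidedLimits T x xm xp) {t : ℝ} (ht : t ∈ Icc 0 T) {η β ζ : ℝ} (hη : 0 < η)
    (hβ : 0 < β) (hζ : 0 < ζ) (Z : Finset (Vec d))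
    (hZ : ∀ z, z ∈ Metric.closedBall 0 M → z ∈ critSet E t (u t) → z ∈ Z)
    (hZm : xm t ∈ Z) (hZp : xp t ∈ Z) :
    Joined E t (u t) (xm t) (xp t)
      ((1 + η) * (Function.rightLim G t - Function.leftLim G t + ζ) +
        2 ^ (Z.card + 1) * β) := by
  obtain ⟨r, hr, hjoin⟩ := h.energy.exists_radius h.pos ht (u t) Z hβ
  -- All critical points in the ball of radius `M` have been cut out, so compactness bounds the
  -- frozen force below by some `c > 0` on `Q`.
  set Q : Set (Vec d) := Metric.closedBall 0 M \ ⋃ z ∈ Z, Metric.ball z r with hQ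
  have hQc : IsCompact Q :=
    (isCompact_closedBall 0 M).diff (isOpen_biUnion fun z _ => Metric.isOpen_ball)
  have hgc : ContinuousOn (fun w => ‖gradX E t w - u t‖) Q :=
    (((h.energy.continuousOn_gradX h.pos).comp (continuousOn_const.prodMk continuousOn_id)
      (fun y _ => ⟨ht, mem_univ _⟩)).sub continuousOn_const).norm
  obtain ⟨c, hc, hcQ⟩ := hQc.exists_forall_le' hgc (a := 0) (fun w hw => by
    rw [norm_pos_iff, sub_ne_zero]
    intro hcrit
    exact hw.2 (mem_biUnion (hZ w hw.1 hcrit) (Metric.mem_ball_self hr)))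
  -- The bound `κ ≤ c / 2` keeps the true force at least `c / 2`; then `κ ≤ η c / 2` is at most `η`
  -- times the true force, so the frozen force is at most `1 + η` times the true one.
  set κ := min (c / 2) (η * c / 2) with hκ
  have hκ0 : 0 < κ := lt_min (by positivity) (by positivity)
  obtain ⟨δ, hδ, N, hN⟩ := h.energy.exists_force_close h.pos h.unif h.control_cont
    (isCompact_closedBall (0 : Vec d) M) ht hκ0
  obtain ⟨a, ha, hat, haδ, haG, hax⟩ := h.exists_left_approx hx ht hδ hr (half_pos hζ)
  obtain ⟨b, hb, htb, hbδ, hbG, hbx⟩ := h.exists_right_approx hx ht hδ hr (half_pos hζ)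
  have e1 := ((h.tendsto_dissipation b).sub (h.tendsto_dissipation a)).eventually_lt_const
    (show G b - G a < Function.rightLim G t - Function.leftLim G t + ζ by linarith)
  have e2 := ((h.tendsto_state a ha).dist (tendsto_const_nhds (x := xm t))).eventually_lt_const hax
  have e3 := ((h.tendsto_state b hb).dist (tendsto_const_nhds (x := xp t))).eventually_lt_const hbx
  obtain ⟨n, ⟨⟨hn1, hn2⟩, hn3⟩, hnN⟩ :=
    (((e1.and e2).and e3).and (eventually_ge_atTop N)).exists
  rw [extDissipation_of_mem h.pos _ _ ha, extDissipation_of_mem h.pos _ _ hb] at hn1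
  have hab : a ≤ b := hat.trans htb
  have hsub : Icc a b ⊆ Icc 0 T := Icc_subset_Icc ha.1 hb.2
  have hDmono := (h.sol n).monotoneOn_dissipation h.pos h.energy h.field (h.viscosity_pos n)
  have key := Joined.of_balls (E := E) (t := t) (u := u t) (γ := xn n)
    (A := fun s => (1 + η) * dissipation T E f (xn n) (un n) s)
    ((h.sol n).continuousOn_state.mono hsub)
    (fun s hs s' hs' hss => mul_le_mul_of_nonneg_left (hDmono (hsub hs) (hsub hs') hss)
      (by positivity)) hβ.le Z hjoin (fun p hp q hq hpq hav => ?_) hab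
  -- The two joins to the one-sided limits cost `2 β`, which turns the factor `2 ^ (Z.card + 1) - 2`
  -- into `2 ^ (Z.card + 1)`.
  · have j1 := (hjoin _ hZm (xn n a) hn2.le).2
    have j2 := (hjoin _ hZp (xn n b) hn3.le).1
    refine ((j1.trans key).trans j2).mono ?_
    have h1 : (1 + η) * (dissipation T E f (xn n) (un n) b - dissipation T E f (xn n) (un n) a) ≤
        (1 + η) * (Function.rightLim G t - Function.leftLim G t + ζ) :=
      mul_le_mul_of_nonneg_left hn1.le (by positivity)
    linarith
  · have hfar : ∀ s ∈ Ioo p q, c ≤ ‖gradX E t (xn n s) - u t‖ ∧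
        ‖(gradX E s (xn n s) - un n s) - (gradX E t (xn n s) - u t)‖ ≤ κ := by
      intro s hs
      have hsI : s ∈ Icc a b := ⟨hp.1.trans hs.1.le, hs.2.le.trans hq.2⟩
      have hball : xn n s ∈ Metric.closedBall (0 : Vec d) M := by
        simpa using h.state_le n s (hsub hsI)
      refine ⟨hcQ _ ⟨hball, fun hmem => ?_⟩, hN n hnN s (hsub hsI) ?_ _ hball⟩
      · obtain ⟨z, hz, hzs⟩ := mem_iUnion₂.1 hmem
        exact hav s hs z hz (Metric.ball_subset_closedBall hzs)
      · rw [abs_lt] at haδ hbδ ⊢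
        constructor <;> linarith [hsI.1, hsI.2]
    rw [← mul_sub]
    refine (h.sol n).joined h.pos h.energy h.field (h.viscosity_pos n) hη.le (hsub hp) (hsub hq)
      hpq (fun s hs hcrit => ?_) (fun s hs => ?_)
    · have h1 := (hfar s hs).1
      have h2 : gradX E t (xn n s) = u t := hcrit
      rw [h2, sub_self, norm_zero] at h1
      linarith
    · obtain ⟨h1, h2⟩ := hfar s hs
      have h3 := norm_sub_norm_le (gradX E t (xn n s) - u t) (gradX E s (xn n s) - un n s)
      rw [norm_sub_rev] at h2
      have h4 : κ ≤ c / 2 := min_le_left _ _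
      have h5 : κ ≤ η * c / 2 := min_le_right _ _
      have h6 : c / 2 ≤ ‖gradX E s (xn n s) - un n s‖ := by linarith
      have h7 := mul_le_mul_of_nonneg_left h6 hη.le
      linarith

/-- The jumps of the limit have optimal cost. -/
theorem transitionCost_eq (h : ConvergentSolutionSeq T E f ε xn un u M U P K x G)
    (hx : IsOneSidedLimits T x xm xp) {t : ℝ} (ht : t ∈ atomSet T (defectMeasure T h.mono)) :
    transitionCost E t (xm t) (xp t) (u t) = defectMeasure T h.mono {t} := by
  obtain ⟨htI, hpos⟩ := ht
  rw [defectMeasure_singleton h.mono htI] at hpos ⊢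
  set g := Function.rightLim G t - Function.leftLim G t with hg
  have hg0 : 0 < g := ENNReal.ofReal_pos.1 hpos
  have hdrop : g = corrEnergy E t (xm t) (u t) - corrEnergy E t (xp t) (u t) := by
    rw [hg, h.leftLim_G hx htI, h.rightLim_G hx htI]; ring
  have hne : xm t ≠ xp t := by
    intro heq
    rw [heq, sub_self] at hdrop
    exact hg0.ne' hdrop
  refine le_antisymm ?_ ?_
  -- The endpoints are added by hand: at times `0` and `T` the conventional values `x(0)` and `x(T)`
  -- need not be critical.
  · obtain ⟨Z, hZ⟩ : ∃ Z : Finset (Vec d), ∀ z, z ∈ Z ↔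
        z ∈ (Metric.closedBall 0 M ∩ critSet E t (u t)) ∪ {xm t, xp t} :=
      ⟨((h.energy.finite_critSet_inter h.pos htI (u t) (isCompact_closedBall 0 M)).union
        (Set.toFinite {xm t, xp t})).toFinset, fun z => Set.Finite.mem_toFinset _⟩
    refine ENNReal.le_of_forall_pos_le_add fun ξ hξ _ => ?_
    have hξ' : (0 : ℝ) < ξ := hξ
    -- Each of the three errors, from `η`, from the segments and from `ζ`, is at most `ξ / 4`.
    have hj := h.exists_joined hx htI (η := ξ / (4 * (g + ξ))) (β := ξ / (4 * 2 ^ (Z.card + 1)))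
      (ζ := ξ / 4) (by positivity) (by positivity) (by positivity) Z
      (fun z h1 h2 => (hZ z).2 (Or.inl ⟨h1, h2⟩)) ((hZ _).2 (Or.inr (Or.inl rfl)))
      ((hZ _).2 (Or.inr (Or.inr rfl)))
    refine hj.transitionCost_le.trans ?_
    rw [← ENNReal.ofReal_coe_nnreal, ← ENNReal.ofReal_add hg0.le hξ'.le]
    refine ENNReal.ofReal_le_ofReal ?_
    rw [← hg]
    have h1 : (2 : ℝ) ^ (Z.card + 1) * (ξ / (4 * 2 ^ (Z.card + 1))) = ξ / 4 := by
      field_simp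
    have h2 : ξ / (4 * (g + ξ)) * (g + ξ / 4) ≤ (ξ : ℝ) / 4 := by
      have h3 : (ξ : ℝ) / (4 * (g + ξ)) * (g + ξ) = ξ / 4 := by field_simp
      refine le_trans (mul_le_mul_of_nonneg_left (by linarith) (by positivity)) h3.le
    rw [h1]
    nlinarith
  · rw [hdrop, transitionCost, if_neg hne]
    exact le_iInf₂ fun θ hθ => hθ.energy_drop_le h.energy htI

end ConvergentSolutionSeq

end CriticalEvolution

/-! ### Proof of the theorem -/

open CriticalEvolution
theorem theorem2p2 (d : ℕ) (T : ℝ) (hT : 0 < T)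
    (E : ℝ → Vec d → ℝ) (hE : IsEnergy T E)
    (f : Vec d → Vec d) (hf : IsControlField f)
    (ε : ℕ → ℝ) (hε_pos : ∀ n, 0 < ε n) (hε : Tendsto ε atTop (𝓝 0))
    (x₀n u₀n : ℕ → Vec d) (x₀ u₀ : Vec d)
    (hx₀ : Tendsto x₀n atTop (𝓝 x₀)) (hu₀ : Tendsto u₀n atTop (𝓝 u₀))
    (xε uε : ℕ → ℝ → Vec d)
    (hsol : ∀ n, IsSolution T E f (ε n) (x₀n n) (u₀n n) (xε n) (uε n)) :
    ∃ (x u : ℝ → Vec d) (ν : Measure ℝ) (φ : ℕ → ℕ),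
      MemLp x ⊤ (volume.restrict (Icc 0 T)) ∧
      ContinuousOn u (Icc 0 T) ∧
      IsFiniteMeasure ν ∧ ν (Icc 0 T)ᶜ = 0 ∧
      -- (a)
      StrictMono φ ∧
      (∀ p : ENNReal, 1 ≤ p → p ≠ ⊤ →
        Tendsto (fun k => eLpNorm (fun t => xε (φ k) t - x t) p (volume.restrict (Icc 0 T)))
          atTop (𝓝 0)) ∧
      (∀ t ∈ Icc 0 T, Tendsto (fun k => xε (φ k) t) atTop (𝓝 (x t))) ∧
      TendstoUniformlyOn (fun k => uε (φ k)) u atTop (Icc 0 T) ∧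
      -- (b)
      (∀ t ∈ Icc 0 T, HasDerivWithinAt u (f (u t)) (Icc 0 T) t) ∧ u 0 = u₀ ∧
      ∃ xm xp : ℝ → Vec d,
        -- (c)
        IsOneSidedLimits T x xm xp ∧
        (∀ t ∈ Ioc 0 T, xm t ∈ critSet E t (u t)) ∧
        (∀ t ∈ Ico 0 T, xp t ∈ critSet E t (u t)) ∧
        -- (d)
        (atomSet T ν).Countable ∧ atomSet T ν = discontinuitySet T x ∧
        -- (e)
        IntegrableOn (fun τ => partialT T E τ (x τ) - inner ℝ (f (u τ)) (x τ)) (Icc 0 T) ∧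
        (∀ s ∈ Icc 0 T, ∀ t ∈ Icc 0 T, s ≤ t →
          corrEnergy E t (xp t) (u t) + ν.real (Icc s t) =
            corrEnergy E s (xm s) (u s) +
              ∫ τ in s..t, (partialT T E τ (x τ) - inner ℝ (f (u τ)) (x τ))) ∧
        -- (f)
        (∀ t ∈ atomSet T ν, transitionCost E t (xm t) (xp t) (u t) = ν {t}) := by
  obtain ⟨u, hunif, hu, hu0, U, hU0, hU⟩ := hf.exists_tendstoUniformlyOn hT hu₀
    (fun n => (hsol n).control) (fun n => (hsol n).control_zero)
  have hucont : ContinuousOn u (Icc 0 T) := fun t ht => (hu t ht).continuousWithinAt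
  have h0 : (0 : ℝ) ∈ Icc 0 T := left_mem_Icc.2 hT.le
  -- Convergence of the initial data bounds the initial energies, the only input the a priori bounds
  -- require besides the bound on the controls.
  have hG₀ : Tendsto (fun n => corrEnergy E 0 (xε n 0) (uε n 0)) atTop
      (𝓝 (corrEnergy E 0 x₀ u₀)) := by
    have hc : Continuous (fun q : Vec d × Vec d => corrEnergy E 0 q.1 q.2) := by
      have h1 := ((hE.contDiff_corrEnergy h0 0).continuous).comp
        (continuous_fst (X := Vec d) (Y := Vec d))
      refine (h1.sub (continuous_snd.inner continuous_fst)).congr fun q => ?_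
      simp [corrEnergy]
    simp only [(hsol _).state_zero, (hsol _).control_zero]
    exact (hc.tendsto (x₀, u₀)).comp (hx₀.prodMk_nhds hu₀)
  obtain ⟨G₀, hG₀b⟩ := hG₀.bddAbove_range
  obtain ⟨M, P, K, -, -, -, hb⟩ := IsSolution.exists_bounds hT hE hf hU0 G₀
  have hbn := fun n => hb (ε n) _ _ (xε n) (uε n) (hε_pos n) (hsol n) (hU n) (hG₀b ⟨n, rfl⟩)
  have hseq : SolutionSeq T E f ε xε uε u M U P K :=
    { pos := hT
      energy := hE
      field := hf
      viscosity_pos := hε_pos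
      viscosity := hε
      sol := fun n => ⟨(hsol n).state, (hsol n).control, rfl, rfl⟩
      unif := hunif
      control_cont := hucont
      state_le := fun n t ht => (hbn n t ht).1
      control_le := hU
      power_le := fun n t ht => (hbn n t ht).2.1
      dissipation_le := fun n t ht => (hbn n t ht).2.2 }
  obtain ⟨φ, hφ, x, G, hG, hlimG, hlimx⟩ := hseq.exists_subseq
  have h : ConvergentSolutionSeq T E f (ε ∘ φ) (xε ∘ φ) (uε ∘ φ) u M U P K x G :=
    { hseq.comp hφ with mono := hG, tendsto_dissipation := hlimG, tendsto_state := hlimx }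
  obtain ⟨xm, xp, hx, hxm, hxp⟩ := h.exists_oneSidedLimits
  exact ⟨x, u, ConvergentSolutionSeq.defectMeasure T h.mono, φ, h.memLp_top_state, hucont,
    ConvergentSolutionSeq.isFiniteMeasure_defectMeasure h.mono,
    ConvergentSolutionSeq.defectMeasure_compl h.mono, hφ,
    fun p hp hp' => h.tendsto_eLpNorm hp hp', hlimx, h.unif, hu, hu0, xm, xp, hx, hxm, hxp,
    ConvergentSolutionSeq.countable_atomSet h.mono, h.atomSet_eq_discontinuitySet hx,
    h.integrableOn_power, fun s hs t ht hst => h.energy_balance hx hs ht hst,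
    fun t ht => h.transitionCost_eq hx ht⟩
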